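/- Let $A$ be a finite alphabet. Atomic operations are the letters $a\in A$, the backspace $\leftarrow$ and the arrows $\blacktriangleleft,\blacktriangleright$. They act on configurations $(u,v)\in A^*\times A^*$ (the text to the left and to the right of the cursor) by $(u,v)\cdot a=(ua,v)$, $(ua,v)\cdot{\leftarrow}=(u,v)$, $(ua,v)\cdot{\blacktriangleleft}=(u,av)$, $(u,av)\cdot{\blacktriangleright}=(ua,v)$, and $(\epsilon,v)\cdot{\leftarrow}=(\epsilon,v)\cdot{\blacktriangleleft}=(\epsilon,v)$, $(u,\epsilon)\cdot{\blacktriangleright}=(u,\epsilon)$. A key is a finite word of atomic operations; keys and sequences of keys act by composition, from left to right. A keyboard is a pair $K=(T,F)$ of finite sets of keys; its language $L(K)$ is the set of words $uv$ such that $(\epsilon,\epsilon)\cdot t_1\cdots t_n=(u,v)$ for some $n\ge 1$, $t_1,\dots,t_{n-1}\in T$, $t_n\in F$; then $t_1\cdots t_n$ is called an accepting execution, of length $n$, that generates $uv$. The size of $K$ is $|K|=\sum_{t\in T\cup F}(|t|+1)$. The keyboard $K$ is in the class $\mathsf{EAK}$ if no key of $T\cup F$ contains the backspace. A linear bounded automaton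 is a nondeterministic Turing machine with one tape, which on input $w$ holds $w$ between two endmarkers; the head starts on the left endmarker and never passes, overwrites or newly prints an endmarker; a word is accepted if some computation reaches an accepting state. Its size is the number of its states plus the number of its tape symbols (letters of $A$ and endmarkers included) plus the number of its transitions plus the number of its accepting states. A language is context-sensitive if it is generated by a grammar with finitely many productions $\alpha\to\beta$ such that $\alpha$ contains a nonterminal and $|\alpha|\le|\beta|$, where the production $S\to\epsilon$ from the start symbol $S$ is also allowed if $S$ is on the right-hand side of no production. **Theorem.** There is a polynomial $p$ with natural coefficients such that for every finite alphabet $A$: 1. There is a computable construction which, for every $\mathsf{EAK}$ keyboard $K=(T,F)$ over $A$, given by repetition-free lists of the keys of $T$ and of $F$, produces a linear bounded automaton $\mathcal{A}_K$ with input alphabet $A$ such that $L(\mathcal{A}_K)=L(K)$ and the size of $\mathcal{A}_K$ is at most $p(|A|+|K|)$. 2. For every $\mathsf{EAK}$ keyboard $K$ over $A$, the language $L(K)$ is context-sensitive. 3. For every $\mathsf{EAK}$ keyboard $K$ over $A$, every word $w\in L(K)$ is generated by an accepting execution of length at most $|w|^2+1$. -/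

import Mathlib

/-! ### Keyboards -/

/-- Atomic operations over the alphabet `A`: writing a letter, the backspace, the two arrows. -/
inductive AtomicOp (A : Type*) where
  | letter (a : A)
  | backspace
  | left
  | right

/-- A key is a finite word of atomic operations. -/
abbrev Key (A : Type*) := List (AtomicOp A)

/-- A configuration `(u, v)`: the word `u` is to the left of the cursor, the word `v` is to its
right, and both are written in reading order. -/
abbrev KeyConfig (A : Type*) := List A × List A

namespace KeyConfig

variable {A : Type*}

/-- The action of one atomic operation. Backspace and arrows have no effect at the edges. -/
def act : KeyConfig A → AtomicOp A → KeyConfig A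
  | (u, v), .letter a => (u ++ [a], v)
  | (u, v), .backspace => (u.dropLast, v)
  | (u, v), .left =>
      match u.getLast? with
      | none => (u, v)
      | some a => (u.dropLast, a :: v)
  | (u, []), .right => (u, [])
  | (u, a :: v), .right => (u ++ [a], v)

/-- The action of a key: its operations are applied from left to right. -/
def actKey (c : KeyConfig A) (t : Key A) : KeyConfig A := t.foldl act c

/-- The action of a sequence of keys. -/
def actKeys (c : KeyConfig A) (τ : List (Key A)) : KeyConfig A := τ.foldl actKey c

end KeyConfig

/-- A keyboard (with entry): a finite set of transient keys and a finite set of final keys. -/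
structure Keyboard (A : Type*) where
  transient : Finset (Key A)
  final : Finset (Key A)

namespace Keyboard

variable {A : Type*}

/-- `τ` is the sequence of keys of an accepting execution: finitely many (possibly no) transient
keys followed by exactly one final key. -/
def IsAccepting (K : Keyboard A) (τ : List (Key A)) : Prop :=
  ∃ (ts : List (Key A)) (f : Key A), τ = ts ++ [f] ∧ (∀ t ∈ ts, t ∈ K.transient) ∧ f ∈ K.final

/-- `τ` is an accepting execution, started in the empty configuration, that writes `w`. -/
def Generates (K : Keyboard A) (τ : List (Key A)) (w : List A) : Prop :=
  K.IsAccepting τ ∧ ∃ u v : List A, KeyConfig.actKeys ([], []) τ = (u, v) ∧ w = u ++ v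

/-- The language recognized by a keyboard. -/
def language (K : Keyboard A) : Language A := {w | ∃ τ, K.Generates τ w}

/-- The class `EAK`: arrows and entry are allowed, the backspace is not. -/
def IsEAK (K : Keyboard A) : Prop :=
  (∀ t ∈ K.transient, AtomicOp.backspace ∉ t) ∧ (∀ t ∈ K.final, AtomicOp.backspace ∉ t)

open Classical in
/-- The size `|K|`: the sum of `|t| + 1` over the keys `t ∈ T ∪ F`. -/
noncomputable def size (K : Keyboard A) : ℕ :=
  ∑ t ∈ K.transient ∪ K.final, (t.length + 1)

end Keyboard

/-! ### Linear bounded automata -/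

/-- The symbols on the tape of a linear bounded automaton with input alphabet `A`: the two
endmarkers, the input letters, and auxiliary symbols, which are named by natural numbers. -/
inductive TapeSymbol (A : Type*) where
  | leftEnd
  | rightEnd
  | input (a : A)
  | aux (i : ℕ)

/-- Head moves. -/
inductive HeadMove where
  | left
  | stay
  | right

/-- The position of the head after a move. -/
def HeadMove.apply : HeadMove → ℕ → ℕ
  | .left, i => i - 1
  | .stay, i => i
  | .right, i => i + 1

/-- A transition `(q, x, q', y, d)`: in state `q`, reading `x`, the automaton may go to state `q'`,
print `y` and move the head by `d`. -/
abbrev LBATransition (A : Type*) := ℕ × TapeSymbol A × ℕ × TapeSymbol A × HeadMove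

/-- A (nondeterministic) linear bounded automaton with input alphabet `A`. Its states are
`0, …, numStates - 1`; its tape alphabet consists of the two endmarkers, the letters of `A` and
`numAux` auxiliary symbols. Endmarkers are never overwritten, never printed elsewhere and never
passed by the head, so the head only uses the cells that held the input. -/
structure LBA (A : Type*) where
  numStates : ℕ
  numAux : ℕ
  start : ℕ
  accept : List ℕ
  trans : List (LBATransition A)
  start_lt : start < numStates
  accept_lt : ∀ q ∈ accept, q < numStates
  state_lt : ∀ q x q' y d, (q, x, q', y, d) ∈ trans → q < numStates ∧ q' < numStates
  aux_lt_read : ∀ q i q' y d, (q, .aux i, q', y, d) ∈ trans → i < numAux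
  aux_lt_print : ∀ q x q' i d, (q, x, q', .aux i, d) ∈ trans → i < numAux
  leftEnd_iff : ∀ q x q' y d, (q, x, q', y, d) ∈ trans → (x = .leftEnd ↔ y = .leftEnd)
  rightEnd_iff : ∀ q x q' y d, (q, x, q', y, d) ∈ trans → (x = .rightEnd ↔ y = .rightEnd)
  leftEnd_move : ∀ q q' y d, (q, .leftEnd, q', y, d) ∈ trans → d ≠ .left
  rightEnd_move : ∀ q q' y d, (q, .rightEnd, q', y, d) ∈ trans → d ≠ .right

/-- A configuration of a linear bounded automaton: state, tape content, position of the head. -/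
structure LBAConfig (A : Type*) where
  state : ℕ
  tape : List (TapeSymbol A)
  pos : ℕ

namespace LBA

variable {A : Type*}

/-- The initial configuration on `w`: the tape holds `w` between the endmarkers, and the head is
on the left endmarker. -/
def init (M : LBA A) (w : List A) : LBAConfig A where
  state := M.start
  tape := TapeSymbol.leftEnd :: (w.map TapeSymbol.input ++ [TapeSymbol.rightEnd])
  pos := 0

/-- One step of computation. -/
def Step (M : LBA A) (c c' : LBAConfig A) : Prop :=
  ∃ (x y : TapeSymbol A) (d : HeadMove),
    (c.state, x, c'.state, y, d) ∈ M.trans ∧ c.tape[c.pos]? = some x ∧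
      c'.tape = c.tape.set c.pos y ∧ c'.pos = d.apply c.pos

/-- The recognized language: acceptance by reaching an accepting state. -/
def language (M : LBA A) : Language A :=
  {w | ∃ c, Relation.ReflTransGen M.Step (M.init w) c ∧ c.state ∈ M.accept}

/-- The size: the number of states, plus the number of tape symbols, plus the number of
transitions, plus the length of the list of accepting states. -/
def size [Fintype A] (M : LBA A) : ℕ :=
  M.numStates + (Fintype.card A + M.numAux + 2) + M.trans.length + M.accept.length

/-- The description of an automaton as a finite object (its data, without the proofs). -/
def code (M : LBA A) : ℕ × ℕ × ℕ × List ℕ × List (LBATransition A) :=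
  (M.numStates, M.numAux, M.start, M.accept, M.trans)

end LBA

/-! ### Encodings, needed to speak about computable constructions -/

def AtomicOp.equivSum (A : Type*) : AtomicOp A ≃ A ⊕ Fin 3 where
  toFun
    | .letter a => .inl a
    | .backspace => .inr 0
    | .left => .inr 1
    | .right => .inr 2
  invFun
    | .inl a => .letter a
    | .inr 0 => .backspace
    | .inr 1 => .left
    | .inr 2 => .right
  left_inv x := by cases x <;> rfl
  right_inv x := by
    rcases x with a | i
    · rfl
    · fin_cases i <;> rfl

def TapeSymbol.equivSum (A : Type*) : TapeSymbol A ≃ Bool ⊕ A ⊕ ℕ where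
  toFun
    | .leftEnd => .inl false
    | .rightEnd => .inl true
    | .input a => .inr (.inl a)
    | .aux i => .inr (.inr i)
  invFun
    | .inl false => .leftEnd
    | .inl true => .rightEnd
    | .inr (.inl a) => .input a
    | .inr (.inr i) => .aux i
  left_inv x := by cases x <;> rfl
  right_inv x := by rcases x with (_ | _) | _ | _ <;> rfl

def HeadMove.equivFin : HeadMove ≃ Fin 3 where
  toFun
    | .left => 0
    | .stay => 1
    | .right => 2
  invFun
    | 0 => .left
    | 1 => .stay
    | 2 => .right
  left_inv x := by cases x <;> rfl
  right_inv i := by fin_cases i <;> rfl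

instance AtomicOp.instPrimcodable {A : Type*} [Primcodable A] : Primcodable (AtomicOp A) :=
  Primcodable.ofEquiv (A ⊕ Fin 3) (AtomicOp.equivSum A)

instance TapeSymbol.instPrimcodable {A : Type*} [Primcodable A] : Primcodable (TapeSymbol A) :=
  Primcodable.ofEquiv (Bool ⊕ A ⊕ ℕ) (TapeSymbol.equivSum A)

instance HeadMove.instPrimcodable : Primcodable HeadMove :=
  Primcodable.ofEquiv (Fin 3) HeadMove.equivFin

/-! ### Context-sensitive languages -/

/-- A context-sensitive (type 1) grammar in the sense of Hopcroft and Ullman: finitely many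
productions `α → β`, where `α` contains a nonterminal and `|α| ≤ |β|`; the only exception is the
production `S → ε`, allowed if `S` is on the right-hand side of no production. -/
structure ContextSensitiveGrammar (A : Type*) where
  NT : Type
  initial : NT
  rules : Finset (List (Symbol A NT) × List (Symbol A NT))
  exists_nonterminal : ∀ r ∈ rules, ∃ N : NT, Symbol.nonterminal N ∈ r.1
  noncontracting : ∀ r ∈ rules, r.1.length ≤ r.2.length ∨
    (r = ([Symbol.nonterminal initial], []) ∧
      ∀ r' ∈ rules, Symbol.nonterminal initial ∉ r'.2)

namespace ContextSensitiveGrammar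

variable {A : Type*}

/-- One step of derivation: a left-hand side is replaced by the right-hand side. -/
def Produces (G : ContextSensitiveGrammar A) (x y : List (Symbol A G.NT)) : Prop :=
  ∃ r ∈ G.rules, ∃ p q : List (Symbol A G.NT), x = p ++ r.1 ++ q ∧ y = p ++ r.2 ++ q

/-- The generated language. -/
def language (G : ContextSensitiveGrammar A) : Language A :=
  {w | Relation.ReflTransGen G.Produces [Symbol.nonterminal G.initial] (w.map Symbol.terminal)}

end ContextSensitiveGrammar

/-- A language is context-sensitive if a context-sensitive grammar generates it. -/
def Language.IsContextSensitive {A : Type*} (L : Language A) : Prop :=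
  ∃ G : ContextSensitiveGrammar A, G.language = L

/-!
Why the three statements hold, for a keyboard without backspace.

*Short executions.* Letters are never deleted, so along an execution the text only grows, each text
being a subsequence of the next. In a shortest execution for `w` no configuration is repeated before
the last transient key, and there the text has fewer than `|w|` letters: once the text is complete,
the final key can write nothing, and could have been pressed at once. Two configurations whose
halves have equal lengths would have the same text, and hence coincide. So there are at most
`|w| ^ 2` transient keys (`Keyboard.exists_short_execution`).

*Context-sensitivity.* A configuration `(u, v)` is written as a string `⊢ u q v ⊣`, where `q` is the
state of the execution, and each operation rewrites a factor of at most two symbols. The string is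
longer than the text by three, and in the end these three symbols must vanish, which a
noncontracting grammar does not allow directly. Therefore the nonterminals of the grammar are blocks
of several symbols: all blocks of a sentential form are single symbols except for one window of up
to four symbols, which can slide along the string. Thus a nonempty text is represented by as many
blocks as it has letters; the erasure of the three auxiliary symbols only shrinks the window.
The productions are all bounded replacements of blocks that preserve, in every context, the property
of being a string of the simulation (`WindowGrammar.ruleSet`); it remains to show that the moves of the window (`WindowGrammar.derives_windowForm_iff`) and the operations of the keyboard
are among them. Only the empty word needs a production of its own.

*The automaton.* It runs the keyboard backwards, from the configuration `(u, v)` with `u v = w`,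
where `u` ends at a guessed head position, to the empty configuration. Undoing a letter replaces it
by a blank, so one auxiliary symbol suffices, and the tape with the head position determines a
configuration of the keyboard. A state consists of a key, the number of operations of it that remain
to be undone, and a little control information; hence there are polynomially many states and
transitions. Soundness is an invariant of the computation (`BackwardLBA.Invariant`), completeness
undoes the operations one by one (`BackwardLBA.ReachesConfig.undoOp`).
-/

/-! ### Keys without backspace -/

namespace KeyConfig

variable {A : Type*}

/-- The text of a configuration, without the cursor. -/
def text (c : KeyConfig A) : List A := c.1 ++ c.2

@[simp] theorem act_letter (u v : List A) (a : A) :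
    act (u, v) (.letter a) = (u ++ [a], v) := rfl

@[simp] theorem act_left_nil (v : List A) : act ([], v) .left = ([], v) := rfl

@[simp] theorem act_left_concat (u v : List A) (a : A) :
    act (u ++ [a], v) .left = (u, a :: v) := by
  simp [act]

@[simp] theorem act_right_nil (u : List A) : act (u, []) .right = (u, []) := rfl

@[simp] theorem act_right_cons (u v : List A) (a : A) :
    act (u, a :: v) .right = (u ++ [a], v) := rfl

@[simp] theorem actKey_nil (c : KeyConfig A) : actKey c [] = c := rfl

@[simp] theorem actKey_cons (c : KeyConfig A) (o : AtomicOp A) (t : Key A) :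
    actKey c (o :: t) = actKey (act c o) t := rfl

theorem actKey_append (c : KeyConfig A) (s t : Key A) :
    actKey c (s ++ t) = actKey (actKey c s) t := by
  simp [actKey]

@[simp] theorem actKeys_nil (c : KeyConfig A) : actKeys c [] = c := rfl

@[simp] theorem actKeys_cons (c : KeyConfig A) (t : Key A) (τ : List (Key A)) :
    actKeys c (t :: τ) = actKeys (actKey c t) τ := rfl

theorem actKeys_append (c : KeyConfig A) (σ τ : List (Key A)) :
    actKeys c (σ ++ τ) = actKeys (actKeys c σ) τ := by
  simp [actKeys]

/-- Case analysis on an operation other than the backspace: in every case the operation inserts a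
letter or moves the cursor or has no effect at an edge. -/
theorem act_cases {P : KeyConfig A → AtomicOp A → KeyConfig A → Prop}
    (letter : ∀ u v a, P (u, v) (.letter a) (u ++ [a], v))
    (left_nil : ∀ v, P ([], v) .left ([], v))
    (left_concat : ∀ u v a, P (u ++ [a], v) .left (u, a :: v))
    (right_nil : ∀ u, P (u, []) .right (u, []))
    (right_cons : ∀ u v a, P (u, a :: v) .right (u ++ [a], v))
    (c : KeyConfig A) (o : AtomicOp A) (ho : o ≠ .backspace) : P c o (act c o) := by
  obtain ⟨u, v⟩ := c
  cases o with
  | letter a => exact letter u v a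
  | backspace => exact absurd rfl ho
  | left =>
    rcases u.eq_nil_or_concat' with rfl | ⟨u, a, rfl⟩
    · exact left_nil v
    · rw [act_left_concat]
      exact left_concat u v a
  | right =>
    cases v with
    | nil => exact right_nil u
    | cons a v => exact right_cons u v a

/-- The number of letters that an operation writes. -/
def opLetters : AtomicOp A → ℕ
  | .letter _ => 1
  | _ => 0

theorem text_act (c : KeyConfig A) (o : AtomicOp A) (ho : o ≠ .backspace) :
    c.text.Sublist (act c o).text ∧ (act c o).text.length = c.text.length + opLetters o := by
  refine act_cases (P := fun c o d => c.text.Sublist d.text ∧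
    d.text.length = c.text.length + opLetters o) ?_ ?_ ?_ ?_ ?_ c o ho
  · intro u v a
    simp [text, opLetters]
    omega
  all_goals simp [text, opLetters]

theorem text_actKey (c : KeyConfig A) (t : Key A) (ht : AtomicOp.backspace ∉ t) :
    c.text.Sublist (actKey c t).text ∧
      (actKey c t).text.length = c.text.length + (t.map opLetters).sum := by
  induction t generalizing c with
  | nil => simp
  | cons o t ih =>
    simp only [List.mem_cons, not_or] at ht
    obtain ⟨h1, h2⟩ := text_act c o (Ne.symm ht.1)
    obtain ⟨h3, h4⟩ := ih (act c o) ht.2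
    refine ⟨h1.trans h3, ?_⟩
    simp only [actKey_cons, List.map_cons, List.sum_cons]
    omega

theorem text_sublist_actKeys (c : KeyConfig A) (τ : List (Key A))
    (hτ : ∀ t ∈ τ, AtomicOp.backspace ∉ t) : c.text.Sublist (actKeys c τ).text := by
  induction τ generalizing c with
  | nil => simp
  | cons t τ ih =>
    simp only [List.forall_mem_cons] at hτ
    exact (text_actKey c t hτ.1).1.trans (ih _ hτ.2)

end KeyConfig

namespace Keyboard

open KeyConfig

variable {A : Type*}

theorem generates_iff {K : Keyboard A} {τ : List (Key A)} {w : List A} :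
    K.Generates τ w ↔ K.IsAccepting τ ∧ (actKeys ([], []) τ).text = w := by
  unfold Generates
  refine and_congr_right fun _ => ⟨?_, fun h => ⟨_, _, rfl, h.symm⟩⟩
  rintro ⟨u, v, h, rfl⟩
  simp [h, text]

theorem mem_language {K : Keyboard A} {w : List A} :
    w ∈ K.language ↔ ∃ ts f, (∀ t ∈ ts, t ∈ K.transient) ∧ f ∈ K.final ∧
      (actKey (actKeys ([], []) ts) f).text = w := by
  constructor
  · rintro ⟨τ, h⟩
    obtain ⟨⟨ts, f, rfl, hts, hf⟩, h⟩ := generates_iff.1 h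
    exact ⟨ts, f, hts, hf, by simpa [actKeys_append] using h⟩
  · rintro ⟨ts, f, hts, hf, h⟩
    exact ⟨ts ++ [f], generates_iff.2 ⟨⟨ts, f, rfl, hts, hf⟩, by simpa [actKeys_append] using h⟩⟩

/-! ### Short accepting executions -/

/-- In an execution of minimal length, the configurations before the last transient key have fewer
than `|w|` letters, and they are distinguished by the lengths of their two halves, because texts
only grow. -/
theorem exists_short_execution {K : Keyboard A} (hK : K.IsEAK) {w : List A}
    (hw : w ∈ K.language) : ∃ τ, K.Generates τ w ∧ τ.length ≤ w.length ^ 2 + 1 := by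
  classical
  have hex : ∃ m, ∃ ts f, (∀ t ∈ ts, t ∈ K.transient) ∧ f ∈ K.final ∧
      (actKey (actKeys ([], []) ts) f).text = w ∧ ts.length = m := by
    obtain ⟨ts, f, h1, h2, h3⟩ := mem_language.1 hw
    exact ⟨_, ts, f, h1, h2, h3, rfl⟩
  obtain ⟨ts, f, hts, hf, hgen, hlen⟩ := Nat.find_spec hex
  have hmin : ∀ ts' : List (Key A), (∀ t ∈ ts', t ∈ K.transient) →
      (actKey (actKeys ([], []) ts') f).text = w → ts.length ≤ ts'.length := by
    intro ts' h1 h2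
    rw [hlen]
    exact Nat.find_min' hex ⟨ts', f, h1, hf, h2, rfl⟩
  have htake : ∀ i, ∀ t ∈ ts.take i, t ∈ K.transient :=
    fun i t ht => hts t (List.mem_of_mem_take ht)
  have hdrop : ∀ i, ∀ t ∈ ts.drop i, t ∈ K.transient :=
    fun i t ht => hts t (List.mem_of_mem_drop ht)
  let c : ℕ → KeyConfig A := fun i => actKeys ([], []) (ts.take i)
  have hc : ∀ i, actKeys (c i) (ts.drop i) = actKeys ([], []) ts := by
    intro i
    rw [← actKeys_append, List.take_append_drop]
  have hmono : ∀ i j, i ≤ j → (c i).text.Sublist (c j).text := by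
    intro i j hij
    have : ts.take j = ts.take i ++ (ts.drop i).take (j - i) := by
      rw [← List.take_add, Nat.add_sub_cancel' hij]
    simp only [c, this, actKeys_append]
    exact text_sublist_actKeys _ _ fun t ht => hK.1 t (hdrop i t (List.mem_of_mem_take ht))
  obtain ⟨hf1, hf2⟩ := text_actKey (actKeys ([], []) ts) f (hK.2 f hf)
  rw [hgen] at hf1 hf2
  have hshort : ∀ i < ts.length, (c i).text.length < w.length := by
    intro i hi
    have hsub : (c i).text.Sublist (actKeys ([], []) ts).text := by
      rw [← hc i]
      exact text_sublist_actKeys _ _ fun t ht => hK.1 t (hdrop i t ht)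
    by_contra! hle
    -- the last key writes no letter, hence it may be pressed as soon as the text is complete
    have hle' := hsub.length_le
    have heq : (c i).text = w := (hsub.trans hf1).eq_of_length_le hle
    obtain ⟨h1, h2⟩ := text_actKey (c i) f (hK.2 f hf)
    have hfin : (actKey (c i) f).text = w := by
      rw [← heq]
      refine (h1.eq_of_length_le ?_).symm
      omega
    have := hmin (ts.take i) (htake i) hfin
    simp at this
    omega
  have hinj : Set.InjOn (fun i => ((c i).1.length, (c i).2.length)) (Finset.range ts.length) := by
    have key : ∀ i j, i < j → j < ts.length → (c i).1.length = (c j).1.length →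
        (c i).2.length = (c j).2.length → False := by
      intro i j hij hj h1 h2
      have ht : (c i).text = (c j).text :=
        (hmono i j hij.le).eq_of_length (by simp [text, h1, h2])
      have hcij : c i = c j := Prod.ext_iff.2 (List.append_inj ht h1)
      have := hmin (ts.take i ++ ts.drop j)
        (fun t ht => (List.mem_append.1 ht).elim (htake i t) (hdrop j t)) (by
          rw [actKeys_append]
          change (actKey (actKeys (c i) _) f).text = w
          rw [hcij, hc, hgen])
      simp at this
      omega
    intro i hi j hj hij
    simp only [Finset.coe_range, Set.mem_Iio] at hi hj
    simp only [Prod.mk.injEq] at hij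
    rcases lt_trichotomy i j with h | h | h
    · exact (key i j h hj hij.1 hij.2).elim
    · exact h
    · exact (key j i h hi hij.1.symm hij.2.symm).elim
  have hcard : ts.length ≤ w.length ^ 2 := by
    have := Finset.card_le_card_of_injOn (s := Finset.range ts.length)
      (t := Finset.range w.length ×ˢ Finset.range w.length) _ (fun i hi => ?_) hinj
    · simpa [sq] using this
    · have := hshort i (by simpa using hi)
      simp only [text, List.length_append] at this
      simp only [Finset.coe_product, Finset.coe_range, Set.mem_prod, Set.mem_Iio]
      omega
  refine ⟨ts ++ [f], generates_iff.2 ⟨⟨ts, f, rfl, hts, hf⟩, ?_⟩, by simpa using hcard⟩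
  simpa [actKeys_append] using hgen

end Keyboard

/-! ### Grammars with a sliding window -/

namespace WindowGrammar

variable {A Y : Type*}

/-- A list of at most `N` blocks of at most `N` symbols each. -/
def IsSmall (N : ℕ) (s : List (List Y)) : Prop := s.length ≤ N ∧ ∀ b ∈ s, b.length ≤ N

theorem finite_isSmall [Finite Y] (N : ℕ) : {s : List (List Y) | IsSmall N s}.Finite := by
  have : Finite {b : List Y // b.length ≤ N} := (List.finite_length_le Y N).to_subtype
  refine ((List.finite_length_le {b : List Y // b.length ≤ N} N).image
    (List.map Subtype.val)).subset ?_
  rintro s ⟨h1, h2⟩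
  refine ⟨s.attach.map fun b => ⟨b.1, h2 b.1 b.2⟩, by simpa using h1, ?_⟩
  simp

/-- The grammar symbol for a block: the block that consists of the symbol of a single letter is a
terminal, all other blocks are nonterminals. The nonterminal `0` is left free for the start. -/
noncomputable def blockSymbol [Finite Y] (ℓ : A → Y) (b : List Y) : Symbol A ℕ :=
  open Classical in
  if h : ∃ a, b = [ℓ a] then .terminal h.choose
  else .nonterminal ((exists_injective_nat (List Y)).choose b + 1)

section blockSymbol

variable [Finite Y] {ℓ : A → Y}

theorem blockSymbol_letter (hℓ : Function.Injective ℓ) (a : A) :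
    blockSymbol ℓ [ℓ a] = .terminal a := by
  have h : ∃ a', [ℓ a] = [ℓ a'] := ⟨a, rfl⟩
  rw [blockSymbol, dif_pos h]
  exact congrArg Symbol.terminal (hℓ (List.cons.inj h.choose_spec).1).symm

theorem blockSymbol_of_forall_ne {b : List Y} (hb : ∀ a, b ≠ [ℓ a]) :
    ∃ n, blockSymbol ℓ b = .nonterminal n := by
  rw [blockSymbol, dif_neg (by simpa using hb)]
  exact ⟨_, rfl⟩

theorem blockSymbol_ne_start (b : List Y) : blockSymbol ℓ b ≠ .nonterminal 0 := by
  unfold blockSymbol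
  split_ifs <;> simp

theorem blockSymbol_injective : Function.Injective (blockSymbol (A := A) ℓ) := by
  intro b b' h
  unfold blockSymbol at h
  split_ifs at h with h1 h2 h2
  · have e1 := h1.choose_spec
    have e2 := h2.choose_spec
    simp only [Symbol.terminal.injEq] at h
    rw [e1, e2, h]
  · simp only [Symbol.nonterminal.injEq, Nat.add_right_cancel_iff] at h
    exact (exists_injective_nat (List Y)).choose_spec h

end blockSymbol

/-- `a` may be replaced by `b` in every context without leaving the set `Good` of strings. -/
def Preserves (Good : List Y → Prop) (a b : List Y) : Prop :=
  ∀ p q, Good (p ++ a ++ q) → Good (p ++ b ++ q)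

theorem Preserves.refl (Good : List Y → Prop) (a : List Y) : Preserves Good a a :=
  fun _ _ h => h

theorem Preserves.context {Good : List Y → Prop} {a b : List Y} (h : Preserves Good a b)
    (p q : List Y) : Preserves Good (p ++ a ++ q) (p ++ b ++ q) := by
  intro p' q' h'
  simpa using h (p' ++ p) (q ++ q') (by simpa using h')

/-- The productions of the window grammar: the start symbol produces every nonempty small list of
blocks whose concatenation is good, and the empty word if `ε` holds; and a small list of blocks
that are not all terminals may be replaced by a small list of at least as many blocks whenever
this preserves `Good`. That `Good` is preserved in all contexts is part of the definition, so that
soundness of the grammar is automatic; finiteness only needs the bounds on the blocks. -/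
def ruleSet [Finite Y] (ℓ : A → Y) (N : ℕ) (Good : List Y → Prop) (ε : Prop) :
    Set (List (Symbol A ℕ) × List (Symbol A ℕ)) :=
  {r | (r = ([.nonterminal 0], []) ∧ ε) ∨
    (∃ s : List (List Y), IsSmall N s ∧ s ≠ [] ∧ Good s.flatten ∧
      r = ([.nonterminal 0], s.map (blockSymbol ℓ))) ∨
    ∃ s t : List (List Y), IsSmall N s ∧ IsSmall N t ∧ s.length ≤ t.length ∧
      (∃ b ∈ s, ∀ a, b ≠ [ℓ a]) ∧ Preserves Good s.flatten t.flatten ∧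
      r = (s.map (blockSymbol ℓ), t.map (blockSymbol ℓ))}

theorem finite_ruleSet [Finite Y] (ℓ : A → Y) (N : ℕ) (Good : List Y → Prop) (ε : Prop) :
    (ruleSet ℓ N Good ε).Finite := by
  have h := finite_isSmall (Y := Y) N
  refine ((Set.finite_singleton (([.nonterminal 0], []) : List (Symbol A ℕ) × _)).union
    ((h.image fun s => ([.nonterminal 0], s.map (blockSymbol ℓ))).union
    ((h.prod h).image fun s => (s.1.map (blockSymbol ℓ), s.2.map (blockSymbol ℓ))))).subset ?_
  rintro r (⟨rfl, -⟩ | ⟨s, hs, -, -, rfl⟩ | ⟨s, t, hs, ht, -, -, -, rfl⟩)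
  · exact .inl rfl
  · exact .inr (.inl ⟨s, hs, rfl⟩)
  · exact .inr (.inr ⟨(s, t), ⟨hs, ht⟩, rfl⟩)

/-- The window grammar. Its sentential forms are good strings, cut into blocks. -/
noncomputable def grammar [Finite Y] (ℓ : A → Y) (N : ℕ) (Good : List Y → Prop) (ε : Prop) :
    ContextSensitiveGrammar A where
  NT := ℕ
  initial := 0
  rules := (finite_ruleSet ℓ N Good ε).toFinset
  exists_nonterminal := by
    intro r hr
    rw [Set.Finite.mem_toFinset] at hr
    rcases hr with ⟨rfl, -⟩ | ⟨s, -, -, -, rfl⟩ | ⟨s, t, -, -, -, ⟨b, hb, hb'⟩, -, rfl⟩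
    · exact ⟨0, by simp⟩
    · exact ⟨0, by simp⟩
    · obtain ⟨n, hn⟩ := blockSymbol_of_forall_ne hb'
      exact ⟨n, hn ▸ List.mem_map_of_mem hb⟩
  noncontracting := by
    intro r hr
    rw [Set.Finite.mem_toFinset] at hr
    rcases hr with ⟨rfl, -⟩ | ⟨s, -, hs, -, rfl⟩ | ⟨s, t, -, -, hst, -, -, rfl⟩
    · refine .inr ⟨rfl, fun r' hr' => ?_⟩
      rw [Set.Finite.mem_toFinset] at hr'
      rcases hr' with ⟨rfl, -⟩ | ⟨s, -, -, -, rfl⟩ | ⟨s, t, -, -, -, -, -, rfl⟩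
      · simp
      · simp [blockSymbol_ne_start]
      · simp [blockSymbol_ne_start]
    · exact .inl (by simpa [Nat.one_le_iff_ne_zero] using hs)
    · exact .inl (by simpa using hst)

section derivations

variable [Finite Y] (ℓ : A → Y) (N : ℕ) (Good : List Y → Prop) (ε : Prop)

/-- One derivation step of the window grammar. -/
def Rewrites (x y : List (Symbol A ℕ)) : Prop :=
  ∃ r ∈ ruleSet ℓ N Good ε, ∃ p q : List (Symbol A ℕ), x = p ++ r.1 ++ q ∧ y = p ++ r.2 ++ q

theorem mem_language_grammar_iff_reflTransGen (w : List A) :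
    w ∈ (grammar ℓ N Good ε).language ↔
      Relation.ReflTransGen (Rewrites ℓ N Good ε) [.nonterminal 0] (w.map .terminal) := by
  have h : (grammar ℓ N Good ε).Produces = Rewrites ℓ N Good ε := by
    funext x y
    exact propext (exists_congr fun r => and_congr_left fun _ => Set.Finite.mem_toFinset _)
  rw [← h]
  exact Iff.rfl

/-- The sequence of blocks `s` is a sentential form of the window grammar. -/
def Derives (s : List (List Y)) : Prop :=
  Relation.ReflTransGen (Rewrites ℓ N Good ε) [.nonterminal 0] (s.map (blockSymbol ℓ))

variable {ℓ N Good ε}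

theorem Derives.start {s : List (List Y)} (hs : IsSmall N s) (hne : s ≠ [])
    (hg : Good s.flatten) : Derives ℓ N Good ε s := by
  exact .single ⟨_, .inr (.inl ⟨s, hs, hne, hg, rfl⟩), [], [], by simp⟩

theorem Derives.step {p s t q : List (List Y)} (h : Derives ℓ N Good ε (p ++ s ++ q))
    (hs : IsSmall N s) (ht : IsSmall N t) (hst : s.length ≤ t.length)
    (hnt : ∃ b ∈ s, ∀ a, b ≠ [ℓ a]) (hg : Preserves Good s.flatten t.flatten) :
    Derives ℓ N Good ε (p ++ t ++ q) := by
  exact h.tail ⟨_, .inr (.inr ⟨s, t, hs, ht, hst, hnt, hg, rfl⟩), p.map (blockSymbol ℓ),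
    q.map (blockSymbol ℓ), by simp⟩

theorem good_of_derives {x : List (Symbol A ℕ)}
    (h : Relation.ReflTransGen (Rewrites ℓ N Good ε) [.nonterminal 0] x) :
    x = [.nonterminal 0] ∨ (x = [] ∧ ε) ∨
      ∃ s : List (List Y), x = s.map (blockSymbol ℓ) ∧ s ≠ [] ∧ Good s.flatten := by
  induction h with
  | refl => exact .inl rfl
  | tail _ hstep ih =>
    obtain ⟨r, hr, p, q, rfl, rfl⟩ := hstep
    rcases ih with ih | ⟨ih, -⟩ | ⟨s, ih, hs, hg⟩
    · -- the left-hand side is the start symbol, hence so is the replaced string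
      have hr1 : r.1 ≠ [] := by
        rcases hr with ⟨rfl, -⟩ | ⟨s, -, -, -, rfl⟩ | ⟨s, t, -, -, -, ⟨b, hb, -⟩, -, rfl⟩
        · simp
        · simp
        · simpa using List.ne_nil_of_mem hb
      obtain ⟨rfl, h1, rfl⟩ : p = [] ∧ r.1 = [.nonterminal 0] ∧ q = [] := by
        have hlen := congrArg List.length ih
        simp only [List.length_append, List.length_singleton] at hlen
        have := List.length_pos_iff.2 hr1
        obtain rfl : p = [] := List.length_eq_zero_iff.1 (by omega)
        obtain rfl : q = [] := List.length_eq_zero_iff.1 (by omega)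
        exact ⟨rfl, by simpa using ih, rfl⟩
      rcases hr with ⟨rfl, hε⟩ | ⟨s, -, hs, hg, rfl⟩ | ⟨s, t, -, -, -, -, -, rfl⟩
      · exact .inr (.inl ⟨rfl, hε⟩)
      · exact .inr (.inr ⟨s, by simp, hs, hg⟩)
      · have : Symbol.nonterminal 0 ∈ s.map (blockSymbol ℓ) := by
          have h1' : s.map (blockSymbol ℓ) = [.nonterminal 0] := h1
          simp [h1']
        obtain ⟨b, -, hb⟩ := List.mem_map.1 this
        exact absurd hb (blockSymbol_ne_start b)
    · simp only [List.append_eq_nil_iff] at ih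
      rcases hr with ⟨rfl, -⟩ | ⟨s, -, -, -, rfl⟩ | ⟨s, t, -, -, -, ⟨b, hb, -⟩, -, rfl⟩
      · simp at ih
      · simp at ih
      · have h1 : s = [] := by simpa using ih.1.2
        simp [h1] at hb
    · obtain ⟨pr, q', rfl, h1, h2⟩ := List.map_eq_append_iff.1 ih.symm
      obtain ⟨p', r', rfl, h3, h4⟩ := List.map_eq_append_iff.1 h1
      have hstart : r.1 ≠ [.nonterminal 0] := by
        intro h0
        rw [h0] at h4
        obtain ⟨b, -, hb⟩ := List.mem_map.1 (h4 ▸ List.mem_singleton_self _)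
        exact blockSymbol_ne_start b hb
      rcases hr with ⟨rfl, -⟩ | ⟨s, -, -, -, rfl⟩ | ⟨s, t, -, -, hst, ⟨b, hb, -⟩, hp, rfl⟩
      · exact absurd rfl hstart
      · exact absurd rfl hstart
      · obtain rfl : r' = s := List.map_injective_iff.2 blockSymbol_injective h4
        refine .inr (.inr ⟨p' ++ t ++ q', by simp [h2, h3], ?_, ?_⟩)
        · have := List.length_pos_of_mem hb
          have : t ≠ [] := List.length_pos_iff.1 (by omega)
          simp [this]
        · simpa using hp p'.flatten q'.flatten (by simpa using hg)

theorem mem_language_grammar (hℓ : Function.Injective ℓ) {w : List A} :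
    w ∈ (grammar ℓ N Good ε).language ↔
      (w = [] ∧ ε) ∨ Derives ℓ N Good ε (w.map fun a => [ℓ a]) := by
  have hw : (w.map fun a => [ℓ a]).map (blockSymbol ℓ) = w.map Symbol.terminal := by
    simp [Function.comp_def, blockSymbol_letter hℓ]
  rw [mem_language_grammar_iff_reflTransGen, Derives, hw]
  refine ⟨.inr, ?_⟩
  rintro (⟨rfl, hε⟩ | h)
  · exact .single ⟨([.nonterminal 0], []), .inl ⟨rfl, hε⟩, [], [], rfl, rfl⟩
  · exact h

theorem good_of_mem_language (hℓ : Function.Injective ℓ) {w : List A}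
    (h : w ∈ (grammar ℓ N Good ε).language) : (w = [] ∧ ε) ∨ Good (w.map ℓ) := by
  rcases good_of_derives ((mem_language_grammar_iff_reflTransGen ..).1 h) with
    h | ⟨h, hε⟩ | ⟨s, h, hs, hg⟩
  · have : (.nonterminal 0 : Symbol A ℕ) ∈ w.map Symbol.terminal := by
      rw [h]
      exact List.mem_singleton_self _
    simp at this
  · exact .inl ⟨by simpa using h, hε⟩
  · right
    have hw : w.map Symbol.terminal = (w.map fun a => [ℓ a]).map (blockSymbol ℓ) := by
      simp [Function.comp_def, blockSymbol_letter hℓ]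
    rw [hw] at h
    rw [← List.map_injective_iff.2 blockSymbol_injective h] at hg
    rwa [← List.flatMap_def, ← List.map_eq_flatMap] at hg

/-- The string `y`, cut into a window of `k` symbols at its left end and single symbols. -/
def windowForm (k : ℕ) (y : List Y) : List (List Y) :=
  y.take k :: (y.drop k).map fun a => [a]

/-- The window of a sentential form can be moved to the left end: it passes one symbol at a time,
without any change of the string. -/
theorem derives_windowForm_iff {b r : List Y} (p : List Y) (hN : 2 ≤ N) (h2 : 2 ≤ b.length)
    (hbN : b.length ≤ N) :
    Derives ℓ N Good ε ((p.map fun a => [a]) ++ [b] ++ r.map fun a => [a]) ↔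
      Derives ℓ N Good ε (windowForm b.length (p ++ b ++ r)) := by
  induction p using List.reverseRecOn generalizing b r with
  | nil => simp [windowForm]
  | append_singleton p x ih =>
    obtain ⟨b', y, rfl⟩ := (b.eq_nil_or_concat').resolve_left (by rintro rfl; simp at h2)
    simp only [List.length_append, List.length_singleton] at h2 hbN
    have hsl : Derives ℓ N Good ε
          (((p ++ [x]).map fun a => [a]) ++ [b' ++ [y]] ++ r.map fun a => [a]) ↔
        Derives ℓ N Good ε ((p.map fun a => [a]) ++ [x :: b'] ++ (y :: r).map fun a => [a]) := by
      have hs1 : IsSmall N [[x], b' ++ [y]] := ⟨by simpa using hN, by simp; omega⟩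
      have hs2 : IsSmall N [x :: b', [y]] := ⟨by simpa using hN, by simp; omega⟩
      constructor
      · intro h
        have := Derives.step (p := p.map fun a => [a]) (s := [[x], b' ++ [y]])
          (t := [x :: b', [y]]) (q := r.map fun a => [a]) (by simpa using h) hs1 hs2 le_rfl
          ⟨b' ++ [y], by simp, fun a ha => by
            have := congrArg List.length ha
            simp at this
            simp [this] at h2⟩ (by simpa using Preserves.refl Good _)
        simpa using this
      · intro h
        have := Derives.step (p := p.map fun a => [a]) (s := [x :: b', [y]])
          (t := [[x], b' ++ [y]]) (q := r.map fun a => [a]) (by simpa using h) hs2 hs1 le_rfl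
          ⟨x :: b', by simp, fun a ha => by
            have := congrArg List.length ha
            simp at this
            simp [this] at h2⟩ (by simpa using Preserves.refl Good _)
        simpa using this
    rw [hsl, ih (b := x :: b') (r := y :: r) (by simpa using h2) (by simpa using hbN)]
    simp

/-- A rewriting step `a → b` inside the string. The window, of length `k`, is moved over the
occurrence of `a`; afterwards the window has length `k'`, and this may be chosen freely as long as
the number of blocks does not decrease. -/
theorem Derives.rewrite {k k' : ℕ} {p a b q : List Y}
    (h : Derives ℓ N Good ε (windowForm k (p ++ a ++ q))) (hab : Preserves Good a b)
    (hk : 2 ≤ k) (hkN : k ≤ N) (hlen : k ≤ (p ++ a ++ q).length) (hak : a.length ≤ k)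
    (hk' : 1 ≤ k') (hkk' : k' + a.length ≤ k + b.length) (hbN : k + b.length ≤ N + a.length) :
    Derives ℓ N Good ε (windowForm k' (p ++ b ++ q)) := by
  simp only [List.length_append] at hlen
  -- the window starts at `a`, or earlier if the end of the string is too near
  obtain ⟨p₁, p₂, hp, q₁, q₂, hq, hpq⟩ : ∃ p₁ p₂, p = p₁ ++ p₂ ∧ ∃ q₁ q₂, q = q₁ ++ q₂ ∧
      p₂.length + a.length + q₁.length = k := by
    by_cases hc : k ≤ a.length + q.length
    · exact ⟨p, [], by simp, q.take (k - a.length), q.drop (k - a.length), by simp, by simp; omega⟩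
    · refine ⟨p.take (p.length + a.length + q.length - k),
        p.drop (p.length + a.length + q.length - k), by simp, q, [], by simp, by simp; omega⟩
  subst hp hq
  set B := p₂ ++ b ++ q₁ with hB
  have hBlen : B.length = p₂.length + b.length + q₁.length := by simp [hB]; omega
  have hW : (p₂ ++ a ++ q₁).length = k := by simp; omega
  have h1 := (derives_windowForm_iff (r := q₂) (ε := ε) (Good := Good) (ℓ := ℓ) (N := N)
    (b := p₂ ++ a ++ q₁) p₁ (by omega) (by omega) (by omega)).2 (by
      rw [hW]
      simpa using h)
  have h2 := h1.step (t := ((B.take (B.length - k')).map fun x => [x]) ++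
      [B.drop (B.length - k')]) ⟨by simp; omega, by simp at hW ⊢; omega⟩
    ⟨by simp; omega, by
      simp only [List.mem_append, List.mem_map, List.mem_singleton]
      rintro c (⟨x, -, rfl⟩ | rfl)
      · simp
        omega
      · simp
        omega⟩ (by simp) ⟨_, List.mem_singleton_self _, fun x hx => by
          rw [hx] at hW
          simp at hW
          omega⟩ (by
      simp only [List.flatten_append, List.flatten_singleton]
      rw [← List.flatMap_def, List.flatMap_singleton', List.take_append_drop]
      exact hab.context p₂ q₁)
  have hdl : (B.drop (B.length - k')).length = k' := by simp; omega
  have hy : p₁ ++ p₂ ++ b ++ (q₁ ++ q₂) =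
      (p₁ ++ B.take (B.length - k')) ++ B.drop (B.length - k') ++ q₂ := by
    rw [List.append_assoc p₁ (B.take _), List.take_append_drop]
    simp [hB]
  rw [hy]
  rcases hk'.eq_or_lt with rfl | hk'
  · obtain ⟨x, hx⟩ := List.length_eq_one_iff.1 hdl
    rw [hx] at h2 ⊢
    convert h2 using 1
    rcases hz : p₁ ++ B.take (B.length - 1) with _ | ⟨z, zs⟩
    · simp only [List.append_eq_nil_iff] at hz
      simp [windowForm, hz.1, hz.2]
    · have : ((p₁ ++ B.take (B.length - 1)).map fun x => [x]) = (z :: zs).map fun x => [x] := by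
        rw [hz]
      rw [List.map_append] at this
      simp only [← List.append_assoc]
      rw [this]
      simp [windowForm]
  · have := (derives_windowForm_iff (r := q₂) (ε := ε) (Good := Good) (ℓ := ℓ) (N := N)
      (b := B.drop (B.length - k')) (p₁ ++ B.take (B.length - k')) (by omega) (by omega)
      (by omega)).1 (by simpa using h2)
    rwa [hdl] at this

end derivations

end WindowGrammar

/-! ### Languages of keyboards without backspace are context-sensitive -/

/-- The symbols of the strings `⊢ u q v ⊣` that describe a configuration `(u, v)` together with a
state `q` of the execution. -/
inductive EditSymbol (A Q : Type*) where
  | letter (a : A)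
  | leftEnd
  | rightEnd
  | cursor (q : Q)

namespace EditSymbol

variable {A Q : Type*}

instance [Finite A] [Finite Q] : Finite (EditSymbol A Q) :=
  Finite.of_injective (β := A ⊕ Q ⊕ Bool)
    (fun
      | letter a => .inl a
      | cursor q => .inr (.inl q)
      | leftEnd => .inr (.inr false)
      | rightEnd => .inr (.inr true))
    (by rintro (_ | _ | _ | _) (_ | _ | _ | _) h <;> simp_all)

theorem letter_injective : Function.Injective (letter : A → EditSymbol A Q) :=
  fun _ _ h => letter.inj h

end EditSymbol

namespace Keyboard

open KeyConfig EditSymbol WindowGrammar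

variable {A : Type*}

/-- A state of an execution: whether the current key is the final one, and the operations of this
key that remain to be carried out. -/
abbrev Phase (K : Keyboard A) : Type _ :=
  Bool × {r : Key A // ∃ t, (t ∈ K.transient ∨ t ∈ K.final) ∧ r <:+ t}

instance (K : Keyboard A) : Finite K.Phase := by
  have h : {r : Key A | ∃ t, (t ∈ K.transient ∨ t ∈ K.final) ∧ r <:+ t}.Finite := by
    refine (((K.transient.finite_toSet.union K.final.finite_toSet).biUnion fun t _ =>
      (List.finite_toSet t.tails))).subset ?_
    rintro r ⟨t, ht, hr⟩
    simp only [Set.mem_iUnion]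
    exact ⟨t, ht, (List.mem_tails _ _).2 hr⟩
  have := h.to_subtype
  exact Finite.instProd (α := Bool) (β := {r : Key A | _})

/-- An execution can arrive at the configuration `c` in the state `q`. -/
def Reaches (K : Keyboard A) (q : K.Phase) (c : KeyConfig A) : Prop :=
  ∃ (ts : List (Key A)) (s : Key A), (∀ t ∈ ts, t ∈ K.transient) ∧
    s ++ q.2.1 ∈ (bif q.1 then K.final else K.transient) ∧
    actKey (actKeys ([], []) ts) s = c

/-- The strings that occur while the keyboard is simulated: a reachable configuration or, when the
execution has come to its end, a word of the language. The endmarkers may have been erased. -/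
def GoodString (K : Keyboard A) (y : List (EditSymbol A K.Phase)) : Prop :=
  ∃ l r, (l = [] ∨ l = [leftEnd]) ∧ (r = [] ∨ r = [rightEnd]) ∧
    ((∃ q u v, y = (l ++ u.map letter) ++ cursor q :: (v.map letter ++ r) ∧ K.Reaches q (u, v)) ∨
      ∃ w ∈ K.language, y = l ++ w.map letter ++ r)

variable {K : Keyboard A}

theorem goodString_cursor_iff {p z : List (EditSymbol A K.Phase)} {q : K.Phase} :
    K.GoodString (p ++ cursor q :: z) ↔ ∃ u v, (p = u.map letter ∨ p = leftEnd :: u.map letter) ∧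
      (z = v.map letter ∨ z = v.map letter ++ [rightEnd]) ∧ K.Reaches q (u, v) := by
  constructor
  · rintro ⟨l, r, hl, hr, ⟨q', u, v, h, hq⟩ | ⟨w, hw, h⟩⟩
    · rw [eq_comm, List.append_cons_inj_of_notMem] at h
      · obtain ⟨rfl, h, rfl⟩ := h
        cases h
        refine ⟨u, v, ?_, ?_, hq⟩
        · rcases hl with rfl | rfl <;> simp
        · rcases hr with rfl | rfl <;> simp
      · rcases hl with rfl | rfl <;> simp
      · rcases hr with rfl | rfl <;> simp
    · have : cursor q ∈ l ++ w.map letter ++ r := by simp [← h]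
      rcases hl with rfl | rfl <;> rcases hr with rfl | rfl <;> simp at this
  · rintro ⟨u, v, hp, hz, hq⟩
    obtain ⟨l, hl, rfl⟩ : ∃ l, (l = [] ∨ l = [leftEnd]) ∧ p = l ++ u.map letter := by
      rcases hp with rfl | rfl
      exacts [⟨[], by simp⟩, ⟨[leftEnd], by simp⟩]
    obtain ⟨r, hr, rfl⟩ : ∃ r, (r = [] ∨ r = [rightEnd]) ∧ z = v.map letter ++ r := by
      rcases hz with rfl | rfl
      exacts [⟨[], by simp⟩, ⟨[rightEnd], by simp⟩]
    exact ⟨l, r, hl, hr, .inl ⟨q, u, v, rfl, hq⟩⟩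

theorem mem_language_of_goodString {w : List A} (h : K.GoodString (w.map letter)) :
    w ∈ K.language := by
  obtain ⟨l, r, hl, hr, ⟨q, u, v, h, -⟩ | ⟨w', hw', h⟩⟩ := h
  · have : cursor q ∈ w.map (letter : A → EditSymbol A K.Phase) := by simp [h]
    simp at this
  · obtain rfl : l = [] := by
      refine hl.resolve_right ?_
      rintro rfl
      have : leftEnd ∈ w.map (letter : A → EditSymbol A K.Phase) := by simp [h]
      simp at this
    obtain rfl : r = [] := by
      refine hr.resolve_right ?_
      rintro rfl
      have : rightEnd ∈ w.map (letter : A → EditSymbol A K.Phase) := by simp [h]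
      simp at this
    rwa [List.map_injective_iff.2 letter_injective (by simpa using h : w.map _ = w'.map _)]

/-- The state of the execution after one more operation. -/
def Phase.next (b : Bool) {o : AtomicOp A} {r : Key A}
    (h : ∃ t, (t ∈ K.transient ∨ t ∈ K.final) ∧ o :: r <:+ t) : K.Phase :=
  (b, ⟨r, h.imp fun _ ht => ⟨ht.1, (List.suffix_cons o r).trans ht.2⟩⟩)

section rules

variable {b : Bool} {o : AtomicOp A} {r : Key A}
  {h : ∃ t, (t ∈ K.transient ∨ t ∈ K.final) ∧ o :: r <:+ t}

theorem Reaches.next {c : KeyConfig A} {o' : AtomicOp A} (hq : K.Reaches (b, ⟨o :: r, h⟩) c)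
    (ho : o = o') : K.Reaches (Phase.next b h) (act c o') := by
  subst ho
  obtain ⟨ts, s, hts, hs, rfl⟩ := hq
  exact ⟨ts, s ++ [o], hts, by simpa [Phase.next] using hs, by simp [actKey_append]⟩

theorem preserves_letter {a : A} (ho : o = .letter a) :
    Preserves K.GoodString [cursor (b, ⟨o :: r, h⟩)] [letter a, cursor (Phase.next b h)] := by
  intro p z hg
  simp only [List.append_assoc, List.singleton_append] at hg
  obtain ⟨u, v, hp, hz, hq⟩ := goodString_cursor_iff.1 hg
  have := goodString_cursor_iff (p := p ++ [letter a]).2 ⟨u ++ [a], v,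
    hp.imp (fun h => by simp [h]) (fun h => by simp [h]), hz, hq.next ho⟩
  simpa using this

theorem preserves_left_leftEnd (ho : o = .left) :
    Preserves K.GoodString [leftEnd, cursor (b, ⟨o :: r, h⟩)]
      [leftEnd, cursor (Phase.next b h)] := by
  intro p z hg
  have hg' : K.GoodString ((p ++ [leftEnd]) ++ cursor (b, ⟨o :: r, h⟩) :: z) := by simpa using hg
  obtain ⟨u, v, hp, hz, hq⟩ := goodString_cursor_iff.1 hg'
  obtain rfl : u = [] := by
    rcases u.eq_nil_or_concat' with rfl | ⟨u, a, rfl⟩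
    · rfl
    · have := hp.imp (congrArg List.getLast?) (congrArg List.getLast?)
      simp [List.getLast?_cons] at this
  have := goodString_cursor_iff.2 ⟨[], v, hp, hz, hq.next ho⟩
  simpa using this

theorem preserves_left_letter (a : A) (ho : o = .left) :
    Preserves K.GoodString [letter a, cursor (b, ⟨o :: r, h⟩)]
      [cursor (Phase.next b h), letter a] := by
  intro p z hg
  have hg' : K.GoodString ((p ++ [letter a]) ++ cursor (b, ⟨o :: r, h⟩) :: z) := by simpa using hg
  obtain ⟨u, v, hp, hz, hq⟩ := goodString_cursor_iff.1 hg'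
  rcases u.eq_nil_or_concat' with rfl | ⟨u, a', rfl⟩
  · have := hp.imp (congrArg List.getLast?) (congrArg List.getLast?)
    simp at this
  · have hp' : (p = u.map letter ∨ p = leftEnd :: u.map letter) ∧ a = a' := by
      rcases hp with hp | hp
      · rw [List.map_append] at hp
        obtain ⟨h1, h2⟩ := List.append_inj' hp rfl
        exact ⟨.inl h1, by simpa using h2⟩
      · rw [List.map_append, ← List.cons_append] at hp
        obtain ⟨h1, h2⟩ := List.append_inj' hp rfl
        exact ⟨.inr h1, by simpa using h2⟩
    obtain ⟨hp', rfl⟩ := hp'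
    have := goodString_cursor_iff.2 ⟨u, a :: v, hp', hz.imp (congrArg (letter a :: ·))
      (congrArg (letter a :: ·)), act_left_concat u v a ▸ hq.next ho⟩
    simpa using this

theorem preserves_right_rightEnd (ho : o = .right) :
    Preserves K.GoodString [cursor (b, ⟨o :: r, h⟩), rightEnd]
      [cursor (Phase.next b h), rightEnd] := by
  intro p z hg
  simp only [List.append_assoc, List.cons_append, List.nil_append] at hg
  obtain ⟨u, v, hp, hz, hq⟩ := goodString_cursor_iff.1 hg
  obtain rfl : v = [] := by
    cases v with
    | nil => rfl
    | cons a v => simp at hz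
  have := goodString_cursor_iff.2 ⟨u, [], hp, hz, hq.next ho⟩
  simpa using this

theorem preserves_right_letter (a : A) (ho : o = .right) :
    Preserves K.GoodString [cursor (b, ⟨o :: r, h⟩), letter a]
      [letter a, cursor (Phase.next b h)] := by
  intro p z hg
  simp only [List.append_assoc, List.cons_append, List.nil_append] at hg
  obtain ⟨u, v, hp, hz, hq⟩ := goodString_cursor_iff.1 hg
  cases v with
  | nil => simp at hz
  | cons a' v =>
    simp only [List.map_cons, List.cons_append, List.cons.injEq, letter.injEq] at hz
    obtain rfl : a = a' := hz.elim And.left And.left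
    have := goodString_cursor_iff (p := p ++ [letter a]).2 ⟨u ++ [a], v,
      hp.imp (fun h => by simp [h]) (fun h => by simp [h]), hz.imp And.right And.right,
      hq.next ho⟩
    simpa using this

theorem preserves_next_key {t : Key A} (ht : t ∈ (bif b then K.final else K.transient)) {h₀ h₁} :
    Preserves K.GoodString [cursor (false, ⟨[], h₀⟩)] [cursor (b, ⟨t, h₁⟩)] := by
  intro p z hg
  simp only [List.append_assoc, List.singleton_append] at hg ⊢
  obtain ⟨u, v, hp, hz, ts, s, hts, hs, hq⟩ := goodString_cursor_iff.1 hg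
  refine goodString_cursor_iff.2 ⟨u, v, hp, hz, ts ++ [s], [], ?_, ht, ?_⟩
  · have hs' : s ∈ K.transient := by simpa using hs
    simpa [or_imp, forall_and] using ⟨hts, hs'⟩
  · simpa [actKeys_append] using hq

theorem preserves_finish {h₀} : Preserves K.GoodString [cursor (true, ⟨[], h₀⟩)] [] := by
  rintro p z hg
  simp only [List.append_assoc, List.singleton_append] at hg
  obtain ⟨u, v, hp, hz, ts, s, hts, hs, hq⟩ := goodString_cursor_iff.1 hg
  have hw : u ++ v ∈ K.language :=
    mem_language.2 ⟨ts, s, hts, by simpa using hs, by simp [hq, text]⟩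
  rcases hp with rfl | rfl <;> rcases hz with rfl | rfl
  · exact ⟨[], [], by simp, by simp, .inr ⟨_, hw, by simp⟩⟩
  · exact ⟨[], [rightEnd], by simp, by simp, .inr ⟨_, hw, by simp⟩⟩
  · exact ⟨[leftEnd], [], by simp, by simp, .inr ⟨_, hw, by simp⟩⟩
  · exact ⟨[leftEnd], [rightEnd], by simp, by simp, .inr ⟨_, hw, by simp⟩⟩

theorem preserves_leftEnd : Preserves K.GoodString [leftEnd] [] := by
  rintro p z ⟨l, r, hl, hr, hg⟩
  simp only [List.append_assoc, List.cons_append, List.nil_append] at hg ⊢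
  have key : ∀ y, leftEnd ∉ y → p ++ leftEnd :: z = l ++ y → p = [] ∧ z = y := by
    intro y hy heq
    rcases hl with rfl | rfl
    · rw [List.nil_append] at heq
      exact absurd (by simp [← heq]) hy
    · have := (List.append_cons_inj_of_notMem (x₁ := []) (by simp) hy).1 heq.symm
      exact ⟨this.1.symm, this.2.2.symm⟩
  rcases hg with ⟨q, u, v, hg, hq⟩ | ⟨w, hw, hg⟩
  · obtain ⟨rfl, rfl⟩ := key _ (by rcases hr with rfl | rfl <;> simp) hg
    exact ⟨[], r, by simp, hr, .inl ⟨q, u, v, by simp, hq⟩⟩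
  · obtain ⟨rfl, rfl⟩ := key _ (by rcases hr with rfl | rfl <;> simp) hg
    exact ⟨[], r, by simp, hr, .inr ⟨w, hw, by simp⟩⟩

theorem preserves_rightEnd : Preserves K.GoodString [rightEnd] [] := by
  rintro p z ⟨l, r, hl, hr, hg⟩
  simp only [List.append_assoc, List.cons_append, List.nil_append] at hg ⊢
  have key : ∀ y, rightEnd ∉ y → p ++ rightEnd :: z = y ++ r → p = y ∧ z = [] := by
    intro y hy heq
    rcases hr with rfl | rfl
    · refine absurd ?_ hy
      rw [List.append_nil] at heq
      simp [← heq]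
    · have := (List.append_cons_inj_of_notMem (z₁ := []) hy (by simp)).1 heq.symm
      exact ⟨this.1.symm, this.2.2.symm⟩
  rcases hg with ⟨q, u, v, hg, hq⟩ | ⟨w, hw, hg⟩
  · obtain ⟨rfl, rfl⟩ := key (l ++ (u.map letter ++ cursor q :: v.map letter))
      (by rcases hl with rfl | rfl <;> simp) (by simpa using hg)
    exact ⟨l, [], hl, by simp, .inl ⟨q, u, v, by simp, hq⟩⟩
  · obtain ⟨rfl, rfl⟩ := key (l ++ w.map letter)
      (by rcases hl with rfl | rfl <;> simp) (by simpa using hg)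
    exact ⟨l, [], hl, by simp, .inr ⟨w, hw, by simp⟩⟩

end rules

theorem mem_or_mem_of_bif {b : Bool} {t : Key A}
    (ht : t ∈ (bif b then K.final else K.transient)) :
    ∃ t', (t' ∈ K.transient ∨ t' ∈ K.final) ∧ t <:+ t' := by
  refine ⟨t, ?_, List.suffix_rfl⟩
  cases b
  · exact .inl ht
  · exact .inr ht

variable [Finite A]

/-- The configuration `c` in state `q` is a sentential form of the window grammar. The window has
four symbols, one more than the symbols `⊢`, `q`, `⊣`; hence the form has as many blocks as the
text has letters. For the empty text it is a single block with three symbols. -/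
def DerivesConfig (K : Keyboard A) (q : K.Phase) (c : KeyConfig A) : Prop :=
  Derives (A := A) letter 5 K.GoodString ([] ∈ K.language)
    (windowForm (min 4 (c.text.length + 3))
      (leftEnd :: c.1.map letter ++ cursor q :: (c.2.map letter ++ [rightEnd])))

theorem DerivesConfig.rewrite {q q' : K.Phase} {c c' : KeyConfig A}
    {p a b z : List (EditSymbol A K.Phase)} (h : K.DerivesConfig q c)
    (hab : Preserves K.GoodString a b) (ha : a.length ≤ 2)
    (hc : leftEnd :: c.1.map letter ++ cursor q :: (c.2.map letter ++ [rightEnd]) = p ++ a ++ z)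
    (hc' : leftEnd :: c'.1.map letter ++ cursor q' :: (c'.2.map letter ++ [rightEnd]) =
      p ++ b ++ z) (hle : a.length ≤ b.length) (hle' : b.length ≤ a.length + 1) :
    K.DerivesConfig q' c' := by
  have h1 := congrArg List.length hc
  have h2 := congrArg List.length hc'
  simp only [text, DerivesConfig, List.length_append] at h ⊢
  simp only [List.length_append, List.length_cons, List.length_map, List.length_nil] at h1 h2
  rw [hc] at h
  rw [hc']
  refine h.rewrite hab ?_ ?_ ?_ ?_ ?_ ?_ ?_
  all_goals try simp only [List.length_append]
  all_goals omega

theorem DerivesConfig.act {b : Bool} {o : AtomicOp A} {r : Key A}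
    {h : ∃ t, (t ∈ K.transient ∨ t ∈ K.final) ∧ o :: r <:+ t} {c : KeyConfig A}
    (ho : o ≠ .backspace) (hc : K.DerivesConfig (b, ⟨o :: r, h⟩) c) :
    K.DerivesConfig (Phase.next b h) (c.act o) := by
  suffices H : ∀ o', o' = o → K.DerivesConfig (b, ⟨o :: r, h⟩) c →
      K.DerivesConfig (Phase.next b h) (c.act o') from H o rfl hc
  intro o' ho'
  refine act_cases (P := fun c o' d => o' = o → K.DerivesConfig (b, ⟨o :: r, h⟩) c →
    K.DerivesConfig (Phase.next b h) d) ?_ ?_ ?_ ?_ ?_ c o' (ho' ▸ ho) ho'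
  · intro u v a ho hd
    exact hd.rewrite (p := leftEnd :: u.map letter) (z := v.map letter ++ [rightEnd])
      (preserves_letter (b := b) (h := h) ho.symm) (by simp) (by simp) (by simp) (by simp) (by simp)
  · intro v ho hd
    exact hd.rewrite (p := []) (z := v.map letter ++ [rightEnd])
      (preserves_left_leftEnd (b := b) (h := h) ho.symm)
      (by simp) (by simp) (by simp) (by simp) (by simp)
  · intro u v a ho hd
    exact hd.rewrite (p := leftEnd :: u.map letter) (z := v.map letter ++ [rightEnd])
      (preserves_left_letter (b := b) (h := h) a ho.symm)
      (by simp) (by simp) (by simp) (by simp) (by simp)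
  · intro u ho hd
    exact hd.rewrite (p := leftEnd :: u.map letter) (z := [])
      (preserves_right_rightEnd (b := b) (h := h) ho.symm)
      (by simp) (by simp) (by simp) (by simp) (by simp)
  · intro u v a ho hd
    exact hd.rewrite (p := leftEnd :: u.map letter) (z := v.map letter ++ [rightEnd])
      (preserves_right_letter (b := b) (h := h) a ho.symm)
      (by simp) (by simp) (by simp) (by simp) (by simp)

theorem DerivesConfig.actKey {b : Bool} {s : Key A} (hs : .backspace ∉ s) {r : Key A}
    {h : ∃ t, (t ∈ K.transient ∨ t ∈ K.final) ∧ s ++ r <:+ t} {h'} {c : KeyConfig A}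
    (hc : K.DerivesConfig (b, ⟨s ++ r, h⟩) c) :
    K.DerivesConfig (b, ⟨r, h'⟩) (c.actKey s) := by
  induction s generalizing c with
  | nil => exact hc
  | cons o s ih =>
    simp only [List.mem_cons, not_or] at hs
    exact ih hs.2 (hc.act (Ne.symm hs.1))

theorem derivesConfig_actKeys (hK : K.IsEAK) {ts : List (Key A)}
    (hts : ∀ t ∈ ts, t ∈ K.transient) {b : Bool} {t : Key A}
    (ht : t ∈ (bif b then K.final else K.transient)) :
    K.DerivesConfig (b, ⟨t, mem_or_mem_of_bif ht⟩) (actKeys ([], []) ts) := by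
  induction ts using List.reverseRecOn generalizing b t with
  | nil =>
    refine Derives.start (by simp [IsSmall, windowForm, text]) (by simp [windowForm]) ?_
    refine ⟨[leftEnd], [rightEnd], by simp, by simp, .inl ⟨(b, ⟨t, mem_or_mem_of_bif ht⟩), [], [],
      by simp [windowForm, text], [], [], by simp, ht, rfl⟩⟩
  | append_singleton ts s ih =>
    simp only [List.mem_append, List.mem_singleton, or_imp, forall_and, forall_eq] at hts
    have hs : s ++ [] ∈ (bif false then K.final else K.transient) := by simpa using hts.2
    have h1 := (ih hts.1 hs).actKey (hK.1 s hts.2)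
      (h' := ⟨s, .inl hts.2, List.nil_suffix⟩)
    rw [actKeys_append]
    exact h1.rewrite (p := leftEnd :: (actKeys ([], []) (ts ++ [s])).1.map letter)
      (z := (actKeys ([], []) (ts ++ [s])).2.map letter ++ [rightEnd])
      (preserves_next_key ht (h₀ := ⟨s, .inl hts.2, List.nil_suffix⟩)
        (h₁ := mem_or_mem_of_bif ht)) (by simp) (by simp [actKeys_append])
      (by simp [actKeys_append])
      le_rfl (by simp)

theorem derives_of_mem_language (hK : K.IsEAK) {w : List A} (hw : w ∈ K.language) (hne : w ≠ []) :
    Derives (A := A) letter 5 K.GoodString ([] ∈ K.language) (w.map fun a => [letter a]) := by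
  obtain ⟨ts, f, hts, hf, rfl⟩ := mem_language.1 hw
  have hf' : f ++ [] ∈ (bif true then K.final else K.transient) := by simpa using hf
  have h0 := (derivesConfig_actKeys hK hts hf').actKey (hK.2 f hf)
      (h' := ⟨f, .inr hf, List.nil_suffix⟩)
  generalize actKey (actKeys ([], []) ts) f = c at *
  obtain ⟨u, v⟩ := c
  simp only [text, ne_eq] at hne ⊢
  have hlen := List.length_pos_iff.2 hne
  simp only [List.length_append] at hlen
  simp only [DerivesConfig, text, List.length_append] at h0
  -- the cursor and the two endmarkers are erased, and the window shrinks to a single letter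
  have h1 := Derives.rewrite (k' := 3) (p := leftEnd :: u.map letter)
    (q := v.map letter ++ [rightEnd]) (by simpa using h0) preserves_finish (by omega)
    (by omega) (by simp; omega) (by simp) (by simp) (by simp; omega) (by simp)
  have h2 := Derives.rewrite (k' := 2) (p := [])
    (q := u.map letter ++ (v.map letter ++ [rightEnd])) (by simpa using h1) preserves_leftEnd
    (by omega) (by omega) (by simp; omega) (by simp) (by simp) (by simp) (by simp)
  have h3 := Derives.rewrite (k' := 1) (p := u.map letter ++ v.map letter)
    (q := []) (by simpa using h2) preserves_rightEnd
    (by omega) (by omega) (by simp; omega) (by simp) (by simp) (by simp) (by simp)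
  rw [← List.map_append, List.append_nil, List.append_nil] at h3
  generalize u ++ v = w at h3 hne
  cases w with
  | nil => exact absurd rfl hne
  | cons a w => simpa [windowForm, Function.comp_def] using h3

theorem language_isContextSensitive (hK : K.IsEAK) : K.language.IsContextSensitive := by
  refine ⟨grammar letter 5 K.GoodString ([] ∈ K.language), ?_⟩
  ext w
  constructor
  · intro h
    rcases good_of_mem_language letter_injective h with ⟨rfl, h'⟩ | h
    · exact h'
    · exact mem_language_of_goodString h
  · intro h
    rw [mem_language_grammar letter_injective]
    by_cases hw : w = []
    · exact .inl ⟨hw, hw ▸ h⟩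
    · exact .inr (derives_of_mem_language hK h hw)

end Keyboard

/-! ### The automaton that runs a keyboard backwards -/

namespace BackwardLBA

variable {A : Type*}

/-- The states of the automaton, before they are numbered. -/
abbrev State := ℕ × ℕ × ℕ

/-- The cursor is placed and the final key is chosen. -/
abbrev start : State := (0, 0, 0)

/-- A key, at first the final one, has been undone completely. -/
abbrev hub : State := (1, 0, 0)

/-- It is checked that no letter remains. -/
abbrev check : State := (2, 0, 0)

/-- The accepting state. -/
abbrev done : State := (3, 0, 0)

/-- The first `j` operations of key number `k` remain to be undone. -/
abbrev undo (k j : ℕ) : State := (4, k, j)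

/-- As in the state `undo k j`, but the head has gone one cell to the right, and it is not yet
known whether there is a letter. -/
abbrev peek (k j : ℕ) : State := (5, k, j)

/-- The symbol of an erased cell. -/
abbrev blank : TapeSymbol A := .aux 0

/-- The moves of the automaton. The keys are those in `T ++ F`. A cell whose letter has been
deleted is blank. The keyboard configuration has to the left of its cursor the remaining letters
in the cell under the head and in the cells left of it, and to the right of its cursor the
remaining letters in the cells right of the head. -/
inductive Move (T F : List (Key A)) :
    State → TapeSymbol A → State → TapeSymbol A → HeadMove → Prop
  | start_leftEnd : Move T F start .leftEnd start .leftEnd .right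
  | start_input (a : A) : Move T F start (.input a) start (.input a) .right
  | hub_blank : Move T F hub blank hub blank .left
  | hub_rightEnd : Move T F hub .rightEnd hub .rightEnd .left
  | hub_leftEnd : Move T F hub .leftEnd check .leftEnd .right
  | check_blank : Move T F check blank check blank .right
  | check_rightEnd : Move T F check .rightEnd done .rightEnd .stay
  | enter_transient {k t x} (ht : (T ++ F)[k]? = some t) (hk : k < T.length)
      (hx : ∀ i, x = .aux i → i = 0) : Move T F hub x (undo k t.length) x .stay
  | enter_final {k t x} (ht : (T ++ F)[k]? = some t) (hk : T.length ≤ k)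
      (hx : ∀ i, x = .aux i → i = 0) : Move T F start x (undo k t.length) x .stay
  | leave {k t x} (ht : (T ++ F)[k]? = some t)
      (hx : ∀ i, x = .aux i → i = 0) : Move T F (undo k 0) x hub x .stay
  | undo_blank {k j t o} (ht : (T ++ F)[k]? = some t) (ho : t[j]? = some o) :
      Move T F (undo k (j + 1)) blank (undo k (j + 1)) blank .left
  | undo_rightEnd {k j t o} (ht : (T ++ F)[k]? = some t) (ho : t[j]? = some o) :
      Move T F (undo k (j + 1)) .rightEnd (undo k (j + 1)) .rightEnd .left
  | peek_blank {k j t o} (ht : (T ++ F)[k]? = some t) (ho : t[j]? = some o) :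
      Move T F (peek k (j + 1)) blank (undo k (j + 1)) blank .stay
  | peek_rightEnd {k j t o} (ht : (T ++ F)[k]? = some t) (ho : t[j]? = some o) :
      Move T F (peek k (j + 1)) .rightEnd (undo k (j + 1)) .rightEnd .stay
  | toPeek_leftEnd {k j t o} (ht : (T ++ F)[k]? = some t) (ho : t[j]? = some o) :
      Move T F (undo k (j + 1)) .leftEnd (peek k (j + 1)) .leftEnd .right
  | toPeek_blank {k j t o} (ht : (T ++ F)[k]? = some t) (ho : t[j]? = some o) :
      Move T F (undo k (j + 1)) blank (peek k (j + 1)) blank .right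
  | toPeek_input {k j t o} (a : A) (ht : (T ++ F)[k]? = some t) (ho : t[j]? = some o) :
      Move T F (undo k (j + 1)) (.input a) (peek k (j + 1)) (.input a) .right
  | letter {k j t a} (ht : (T ++ F)[k]? = some t) (ho : t[j]? = some (.letter a)) :
      Move T F (undo k (j + 1)) (.input a) (undo k j) blank .stay
  | left_leftEnd {k j t} (ht : (T ++ F)[k]? = some t) (ho : t[j]? = some .left) :
      Move T F (undo k (j + 1)) .leftEnd (undo k j) .leftEnd .stay
  | left_input {k j t} (a : A) (ht : (T ++ F)[k]? = some t) (ho : t[j]? = some .left) :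
      Move T F (peek k (j + 1)) (.input a) (undo k j) (.input a) .stay
  | right_rightEnd {k j t} (ht : (T ++ F)[k]? = some t) (ho : t[j]? = some .right) :
      Move T F (undo k (j + 1)) .rightEnd (undo k j) .rightEnd .stay
  | right_input {k j t} (a : A) (ht : (T ++ F)[k]? = some t) (ho : t[j]? = some .right) :
      Move T F (undo k (j + 1)) (.input a) (undo k j) (.input a) .left

/-! ### The list of the moves -/

/-- A transition whose states are not yet numbered. -/
abbrev Trans (A : Type*) := State × TapeSymbol A × State × TapeSymbol A × HeadMove

section lists

variable (A) [Fintype A]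

/-- The cell contents that are letters. -/
noncomputable def inputs : List (TapeSymbol A) := (Finset.univ : Finset A).toList.map .input

/-- The whole tape alphabet. -/
noncomputable def symbols : List (TapeSymbol A) := .leftEnd :: .rightEnd :: blank :: inputs A

/-- The moves that do not depend on the keys. -/
noncomputable def fixedMoves : List (Trans A) :=
  [(start, .leftEnd, start, .leftEnd, .right), (hub, blank, hub, blank, .left),
    (hub, .rightEnd, hub, .rightEnd, .left), (hub, .leftEnd, check, .leftEnd, .right),
    (check, blank, check, blank, .right), (check, .rightEnd, done, .rightEnd, .stay)] ++
  (inputs A).map fun x => (start, x, start, x, .right)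

variable {A}

/-- A change of state without any other effect. -/
noncomputable def jump (s s' : State) : List (Trans A) :=
  (symbols A).map fun x => (s, x, s', x, .stay)

/-- The moves from `p` and its companion `r` that let the head pass the cells without a letter. -/
noncomputable def freeMoves (p r : State) : List (Trans A) :=
  [(p, blank, p, blank, .left), (p, .rightEnd, p, .rightEnd, .left), (r, blank, p, blank, .stay),
    (r, .rightEnd, p, .rightEnd, .stay), (p, .leftEnd, r, .leftEnd, .right),
    (p, blank, r, blank, .right)] ++
  (inputs A).map fun x => (p, x, r, x, .right)

/-- The moves that undo an operation, from `p` and its companion `r` to `p'`; each is listed with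
the operation that it undoes. -/
noncomputable def allUndoMoves (p r p' : State) : List (AtomicOp A × Trans A) :=
  ((Finset.univ : Finset A).toList.map fun a => (.letter a, p, .input a, p', blank, .stay)) ++
  ([(.left, p, .leftEnd, p', .leftEnd, .stay), (.right, p, .rightEnd, p', .rightEnd, .stay)] ++
  (((inputs A).map fun x => (.left, r, x, p', x, .stay)) ++
  ((inputs A).map fun x => (.right, p, x, p', x, .left))))

open Classical in
/-- The moves that undo the operation `o`. -/
noncomputable def undoMoves (p r p' : State) (o : AtomicOp A) : List (Trans A) :=
  (allUndoMoves p r p').filterMap fun e => if e.1 = o then some e.2 else none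

/-- The moves for operation number `j` of key number `k`. -/
noncomputable def opMoves (k : ℕ) (t : Key A) (j : ℕ) : List (Trans A) :=
  freeMoves (undo k (j + 1)) (peek k (j + 1)) ++
    undoMoves (undo k (j + 1)) (peek k (j + 1)) (undo k j) (t.getD j .backspace)

/-- The moves for key number `k`; the keys with a number less than `n` are transient. -/
noncomputable def keyMoves (n k : ℕ) (t : Key A) : List (Trans A) :=
  jump (if k < n then hub else start) (undo k t.length) ++
    (jump (undo k 0) hub ++ (List.range t.length).flatMap (opMoves k t))

/-- All moves. -/
noncomputable def moves (x : List (Key A) × List (Key A)) : List (Trans A) :=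
  fixedMoves A ++ (List.range (x.1 ++ x.2).length).flatMap fun k =>
    keyMoves x.1.length k ((x.1 ++ x.2).getD k [])

theorem mem_inputs {x : TapeSymbol A} : x ∈ inputs A ↔ ∃ a, x = .input a := by
  simp [inputs, eq_comm]

theorem mem_symbols {x : TapeSymbol A} : x ∈ symbols A ↔ ∀ i, x = .aux i → i = 0 := by
  cases x <;> simp [symbols, mem_inputs]

theorem getElem?_eq_some_iff_getD {α : Type*} {l : List α} {i : ℕ} {d x : α} :
    l[i]? = some x ↔ i < l.length ∧ l.getD i d = x := by
  rw [List.getElem?_eq_some_iff]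
  constructor
  · rintro ⟨h, rfl⟩
    exact ⟨h, by simp [h]⟩
  · rintro ⟨h, rfl⟩
    exact ⟨h, by simp [h]⟩

theorem mem_moves {T F : List (Key A)} {s s' : State} {x y : TapeSymbol A} {d : HeadMove} :
    (s, x, s', y, d) ∈ moves (T, F) ↔ Move T F s x s' y d := by
  constructor
  · intro h
    simp only [moves, List.mem_append, List.mem_flatMap, List.mem_range] at h
    rcases h with h | ⟨k, hk, h⟩
    · simp only [fixedMoves, List.mem_append, List.mem_cons, List.mem_map, mem_inputs,
        List.not_mem_nil, or_false] at h
      rcases h with (h | h | h | h | h | h) | ⟨_, ⟨a, rfl⟩, h⟩ <;> cases h <;> constructor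
    · have ht := (getElem?_eq_some_iff_getD (d := ([] : Key A))).2 ⟨hk, rfl⟩
      generalize (T ++ F).getD k [] = t at h ht
      simp only [keyMoves, jump, List.mem_append, List.mem_flatMap, List.mem_range, List.mem_map,
        mem_symbols] at h
      rcases h with ⟨z, hz, h⟩ | ⟨z, hz, h⟩ | ⟨j, hj, h⟩
      · split_ifs at h with hkn <;> cases h
        · exact .enter_transient ht hkn hz
        · exact .enter_final ht (not_lt.1 hkn) hz
      · cases h
        exact .leave ht hz
      · have ho := (getElem?_eq_some_iff_getD (d := AtomicOp.backspace)).2 ⟨hj, rfl⟩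
        rw [opMoves] at h
        generalize t.getD j .backspace = o at h ho
        simp only [freeMoves, undoMoves, allUndoMoves, List.mem_append, List.mem_cons,
          List.mem_map, List.mem_filterMap, mem_inputs, List.not_mem_nil, or_false,
          Option.ite_none_right_eq_some, Option.some.injEq, Finset.mem_toList, Finset.mem_univ,
          true_and] at h
        rcases h with ((h | h | h | h | h | h) | ⟨_, ⟨a, rfl⟩, h⟩) |
          ⟨e, ⟨a, rfl⟩ | (rfl | rfl) | ⟨_, ⟨a, rfl⟩, rfl⟩ | ⟨_, ⟨a, rfl⟩, rfl⟩, rfl, h⟩ <;> cases h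
        · exact .undo_blank ht ho
        · exact .undo_rightEnd ht ho
        · exact .peek_blank ht ho
        · exact .peek_rightEnd ht ho
        · exact .toPeek_leftEnd ht ho
        · exact .toPeek_blank ht ho
        · exact .toPeek_input a ht ho
        · exact .letter ht ho
        · exact .left_leftEnd ht ho
        · exact .right_rightEnd ht ho
        · exact .left_input a ht ho
        · exact .right_input a ht ho
  · intro h
    have key : ∀ {k t} {e : Trans A}, (T ++ F)[k]? = some t → e ∈ keyMoves T.length k t →
        e ∈ moves (T, F) := by
      intro k t e ht he
      obtain ⟨hk, hd⟩ := (getElem?_eq_some_iff_getD (d := ([] : Key A))).1 ht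
      refine List.mem_append_right _ (List.mem_flatMap.2 ⟨k, List.mem_range.2 hk, ?_⟩)
      rwa [hd]
    have jmp : ∀ {s s' : State} {x : TapeSymbol A}, (∀ i, x = .aux i → i = 0) →
        (s, x, s', x, .stay) ∈ jump s s' :=
      fun hx => List.mem_map.2 ⟨_, mem_symbols.2 hx, rfl⟩
    have free : ∀ {k j t o} {e : Trans A}, (T ++ F)[k]? = some t → t[j]? = some o →
        e ∈ freeMoves (undo k (j + 1)) (peek k (j + 1)) → e ∈ moves (T, F) := by
      intro k j t o e ht ho he
      exact key ht (List.mem_append_right _ (List.mem_append_right _ (List.mem_flatMap.2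
        ⟨j, List.mem_range.2 (getElem?_eq_some_iff_getD (d := o).1 ho).1,
          List.mem_append_left _ he⟩)))
    have eff : ∀ {k j t o} {e : Trans A}, (T ++ F)[k]? = some t → t[j]? = some o →
        (o, e) ∈ allUndoMoves (undo k (j + 1)) (peek k (j + 1)) (undo k j) →
        e ∈ moves (T, F) := by
      intro k j t o e ht ho he
      obtain ⟨hj, hd⟩ := (getElem?_eq_some_iff_getD (d := AtomicOp.backspace)).1 ho
      refine key ht (List.mem_append_right _ (List.mem_append_right _ (List.mem_flatMap.2
        ⟨j, List.mem_range.2 hj, List.mem_append_right _ (List.mem_filterMap.2 ⟨_, he, ?_⟩)⟩)))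
      rw [hd, if_pos rfl]
    cases h with
    | enter_transient ht hk hx =>
      exact key ht (List.mem_append_left _ (by rw [if_pos hk]; exact jmp hx))
    | enter_final ht hk hx =>
      exact key ht (List.mem_append_left _ (by rw [if_neg (not_lt.2 hk)]; exact jmp hx))
    | leave ht hx => exact key ht (List.mem_append_right _ (List.mem_append_left _ (jmp hx)))
    | undo_blank ht ho => exact free ht ho (by simp [freeMoves])
    | undo_rightEnd ht ho => exact free ht ho (by simp [freeMoves])
    | peek_blank ht ho => exact free ht ho (by simp [freeMoves])
    | peek_rightEnd ht ho => exact free ht ho (by simp [freeMoves])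
    | toPeek_leftEnd ht ho => exact free ht ho (by simp [freeMoves])
    | toPeek_blank ht ho => exact free ht ho (by simp [freeMoves])
    | toPeek_input a ht ho => exact free ht ho (by simp [freeMoves, mem_inputs])
    | letter ht ho => exact eff ht ho (by simp [allUndoMoves])
    | left_leftEnd ht ho => exact eff ht ho (by simp [allUndoMoves])
    | left_input a ht ho => exact eff ht ho (by simp [allUndoMoves, mem_inputs])
    | right_rightEnd ht ho => exact eff ht ho (by simp [allUndoMoves])
    | right_input a ht ho => exact eff ht ho (by simp [allUndoMoves, mem_inputs])
    | _ => exact List.mem_append_left _ (by simp [fixedMoves, mem_inputs])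

/-! ### The numbering of the states -/

/-- The number of a state. -/
def State.num (s : State) : ℕ := Nat.pair s.1 (Nat.pair s.2.1 s.2.2)

theorem State.num_injective : Function.Injective State.num := by
  rintro ⟨a, b, c⟩ ⟨a', b', c'⟩ h
  simp only [State.num, Nat.pair_eq_pair] at h
  obtain ⟨rfl, rfl, rfl⟩ := h
  rfl

theorem State.num_lt {s : State} {n : ℕ} (h1 : s.1 < n) (h2 : s.2.1 < n) (h3 : s.2.2 < n) :
    s.num < (n * n) * (n * n) := by
  have hlt : ∀ {a b m : ℕ}, a < m → b < m → Nat.pair a b < m * m := by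
    intro a b m ha hb
    refine (Nat.pair_lt_max_add_one_sq a b).trans_le ?_
    rw [sq]
    have : max a b + 1 ≤ m := by omega
    exact Nat.mul_le_mul this this
  exact hlt (h1.trans_le (Nat.le_mul_self n)) (hlt h2 h3)

/-- A bound for the three components of a state. -/
def stateBound (x : List (Key A) × List (Key A)) : ℕ :=
  (x.1 ++ x.2).length + (x.1 ++ x.2).flatten.length + 6

omit [Fintype A] in
theorem Move.aux_eq_zero {T F : List (Key A)} {s s' : State} {x y : TapeSymbol A} {d : HeadMove}
    (h : Move T F s x s' y d) : (∀ i, x = .aux i → i = 0) ∧ (∀ i, y = .aux i → i = 0) := by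
  cases h with
  | enter_transient _ _ hx => exact ⟨hx, hx⟩
  | enter_final _ _ hx => exact ⟨hx, hx⟩
  | leave _ hx => exact ⟨hx, hx⟩
  | _ => simp

omit [Fintype A] in
theorem Move.num_lt {T F : List (Key A)} {s s' : State} {x y : TapeSymbol A} {d : HeadMove}
    (h : Move T F s x s' y d) :
    s.num < (stateBound (T, F) * stateBound (T, F)) * (stateBound (T, F) * stateBound (T, F)) ∧
      s'.num <
        (stateBound (T, F) * stateBound (T, F)) * (stateBound (T, F) * stateBound (T, F)) := by
  have hk : ∀ {k t}, (T ++ F)[k]? = some t →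
      k < (T ++ F).length ∧ t.length ≤ (T ++ F).flatten.length := by
    intro k t ht
    refine ⟨(List.getElem?_eq_some_iff.1 ht).1, ?_⟩
    rw [List.length_flatten]
    exact List.le_sum_of_mem (List.mem_map_of_mem (List.mem_of_getElem? ht))
  have hj : ∀ {j o} {t : Key A}, t[j]? = some o → j < t.length :=
    fun h => (List.getElem?_eq_some_iff.1 h).1
  suffices H : (s.1 < stateBound (T, F) ∧ s.2.1 < stateBound (T, F) ∧
      s.2.2 < stateBound (T, F)) ∧ (s'.1 < stateBound (T, F) ∧ s'.2.1 < stateBound (T, F) ∧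
      s'.2.2 < stateBound (T, F)) from
    ⟨State.num_lt H.1.1 H.1.2.1 H.1.2.2, State.num_lt H.2.1 H.2.2.1 H.2.2.2⟩
  unfold stateBound
  cases h
  case enter_transient ht _ _ => have := hk ht; simp only; omega
  case enter_final ht _ _ => have := hk ht; simp only; omega
  case leave ht _ => have := hk ht; simp only; omega
  all_goals first
    | (simp only; omega)
    | (rename_i ht ho; have := hk ht; have := hj ho; simp only; omega)

/-- The transitions of the automaton. -/
noncomputable def transitions (x : List (Key A) × List (Key A)) : List (LBATransition A) :=
  (moves x).map fun e => (State.num e.1, e.2.1, State.num e.2.2.1, e.2.2.2)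

theorem exists_move_of_mem_transitions {w : List (Key A) × List (Key A)} {q q' : ℕ}
    {x y : TapeSymbol A} {d : HeadMove} (h : (q, x, q', y, d) ∈ transitions w) :
    ∃ s s', q = State.num s ∧ q' = State.num s' ∧ Move w.1 w.2 s x s' y d := by
  obtain ⟨⟨s, x', s', y', d'⟩, hm, he⟩ := List.mem_map.1 h
  simp only [Prod.mk.injEq] at he
  obtain ⟨rfl, rfl, rfl, rfl, rfl⟩ := he
  exact ⟨s, s', rfl, rfl, mem_moves.1 hm⟩

/-- The automaton. Its states are those with components below `stateBound`, most of them useless. -/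
noncomputable def machine (x : List (Key A) × List (Key A)) : LBA A where
  numStates := (stateBound x * stateBound x) * (stateBound x * stateBound x)
  numAux := 1
  start := start.num
  accept := [done.num]
  trans := transitions x
  start_lt := State.num_lt (by simp [stateBound]) (by simp [stateBound]) (by simp [stateBound])
  accept_lt := by
    simp only [List.mem_singleton, forall_eq]
    exact State.num_lt (by simp [stateBound]) (by simp [stateBound]) (by simp [stateBound])
  state_lt := by
    intro q y q' z d h
    obtain ⟨s, s', rfl, rfl, hm⟩ := exists_move_of_mem_transitions h
    exact hm.num_lt
  aux_lt_read := by
    intro q i q' z d h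
    obtain ⟨s, s', rfl, rfl, hm⟩ := exists_move_of_mem_transitions h
    exact Nat.lt_one_iff.2 (hm.aux_eq_zero.1 i rfl)
  aux_lt_print := by
    intro q y q' i d h
    obtain ⟨s, s', rfl, rfl, hm⟩ := exists_move_of_mem_transitions h
    exact Nat.lt_one_iff.2 (hm.aux_eq_zero.2 i rfl)
  leftEnd_iff := by
    intro q y q' z d h
    obtain ⟨s, s', rfl, rfl, hm⟩ := exists_move_of_mem_transitions h
    cases hm <;> simp
  rightEnd_iff := by
    intro q y q' z d h
    obtain ⟨s, s', rfl, rfl, hm⟩ := exists_move_of_mem_transitions h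
    cases hm <;> simp
  leftEnd_move := by
    intro q q' z d h
    obtain ⟨s, s', rfl, rfl, hm⟩ := exists_move_of_mem_transitions h
    cases hm <;> simp
  rightEnd_move := by
    intro q q' z d h
    obtain ⟨s, s', rfl, rfl, hm⟩ := exists_move_of_mem_transitions h
    cases hm <;> simp

theorem mem_trans_machine {T F : List (Key A)} {s : State} {q' : ℕ} {x y : TapeSymbol A}
    {d : HeadMove} : (s.num, x, q', y, d) ∈ (machine (T, F)).trans ↔
      ∃ s', q' = s'.num ∧ Move T F s x s' y d := by
  constructor
  · intro h
    obtain ⟨s₀, s', hs, rfl, h⟩ := exists_move_of_mem_transitions h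
    obtain rfl := State.num_injective hs
    exact ⟨s', rfl, h⟩
  · rintro ⟨s', rfl, h⟩
    exact List.mem_map.2 ⟨_, mem_moves.2 h, rfl⟩

/-! ### The construction is primitive recursive -/

section primrec

variable [Primcodable A]

open Primrec

theorem primrec_jump : Primrec₂ (jump : State → State → List (Trans A)) := by
  refine list_map (.const _) (Primrec.pair (fst.comp fst) (.pair snd (.pair (snd.comp fst)
    (.pair snd (.const _)))))

theorem primrec_freeMoves : Primrec₂ (freeMoves : State → State → List (Trans A)) := by
  have h : ∀ (x y : TapeSymbol A) (d : HeadMove) {f g : State × State → State}, Primrec f →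
      Primrec g → Primrec fun z => ((f z, x, g z, y, d) : Trans A) := fun x y d f g hf hg =>
    .pair hf (.pair (.const _) (.pair hg (.const _)))
  refine list_append.comp ?_ ?_
  · refine list_cons.comp (h _ _ _ fst fst) (list_cons.comp (h _ _ _ fst fst) (list_cons.comp
      (h _ _ _ snd fst) (list_cons.comp (h _ _ _ snd fst) (list_cons.comp (h _ _ _ fst snd)
      (list_cons.comp (h _ _ _ fst snd) (.const _))))))
  · exact list_map (.const _) (Primrec.pair (fst.comp fst) (.pair snd (.pair (snd.comp fst)
      (.pair snd (.const _)))))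

omit [Fintype A] in
theorem primrec_input : Primrec (TapeSymbol.input : A → TapeSymbol A) :=
  (of_equiv_symm (e := TapeSymbol.equivSum A)).comp (sumInr.comp sumInl)

omit [Fintype A] in
theorem primrec_letter : Primrec (AtomicOp.letter : A → AtomicOp A) :=
  (of_equiv_symm (e := AtomicOp.equivSum A)).comp sumInl

theorem primrec_allUndoMoves : Primrec fun z : State × State × State =>
    (allUndoMoves z.1 z.2.1 z.2.2 : List (AtomicOp A × Trans A)) := by
  have hp : Primrec fun z : State × State × State => z.1 := fst
  have hr : Primrec fun z : State × State × State => z.2.1 := fst.comp snd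
  have hp' : Primrec fun z : State × State × State => z.2.2 := snd.comp snd
  refine list_append.comp ?_ (list_append.comp (list_cons.comp ?_ (list_cons.comp ?_ (.const _)))
    (list_append.comp ?_ ?_))
  · exact list_map (.const _) (Primrec.pair (primrec_letter.comp snd) (.pair (hp.comp fst)
      (.pair (primrec_input.comp snd) (.pair (hp'.comp fst) (.const _)))))
  · exact .pair (.const _) (.pair hp (.pair (.const _) (.pair hp' (.const _))))
  · exact .pair (.const _) (.pair hp (.pair (.const _) (.pair hp' (.const _))))
  · exact list_map (.const _) (Primrec.pair (.const _) (.pair (hr.comp fst) (.pair snd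
      (.pair (hp'.comp fst) (.pair snd (.const _))))))
  · exact list_map (.const _) (Primrec.pair (.const _) (.pair (hp.comp fst) (.pair snd
      (.pair (hp'.comp fst) (.pair snd (.const _))))))

theorem primrec_undoMoves : Primrec fun z : (State × State × State) × AtomicOp A =>
    undoMoves z.1.1 z.1.2.1 z.1.2.2 z.2 := by
  classical
  refine listFilterMap (primrec_allUndoMoves.comp fst) ?_
  refine Primrec.ite (Primrec.eq.comp (fst.comp snd) (snd.comp fst)) ?_ (.const _)
  exact option_some.comp (snd.comp snd)

theorem primrec_undo : Primrec₂ undo := Primrec.pair (.const _) (.pair fst snd)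

theorem primrec_peek : Primrec₂ peek := Primrec.pair (.const _) (.pair fst snd)

theorem primrec_opMoves :
    Primrec fun z : (ℕ × Key A) × ℕ => opMoves z.1.1 z.1.2 z.2 := by
  have hk : Primrec fun z : (ℕ × Key A) × ℕ => z.1.1 := fst.comp fst
  have ht : Primrec fun z : (ℕ × Key A) × ℕ => z.1.2 := snd.comp fst
  have hj : Primrec fun z : (ℕ × Key A) × ℕ => z.2 := snd
  have h1 := primrec_undo.comp hk (succ.comp hj)
  have h2 := primrec_peek.comp hk (succ.comp hj)
  have h3 := primrec_undo.comp hk hj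
  exact list_append.comp (primrec_freeMoves.comp h1 h2)
    (primrec_undoMoves.comp (.pair (.pair h1 (.pair h2 h3)) ((list_getD _).comp ht hj)))

theorem primrec_keyMoves :
    Primrec fun z : ℕ × ℕ × Key A => keyMoves z.1 z.2.1 z.2.2 := by
  have hn : Primrec fun z : ℕ × ℕ × Key A => z.1 := fst
  have hk : Primrec fun z : ℕ × ℕ × Key A => z.2.1 := fst.comp snd
  have ht : Primrec fun z : ℕ × ℕ × Key A => z.2.2 := snd.comp snd
  refine list_append.comp (primrec_jump.comp (Primrec.ite (nat_lt.comp hk hn) (.const _)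
    (.const _)) (primrec_undo.comp hk (list_length.comp ht))) (list_append.comp
    (primrec_jump.comp (primrec_undo.comp hk (.const _)) (.const _)) ?_)
  exact list_flatMap (list_range.comp (list_length.comp ht))
    (primrec_opMoves.comp (.pair (snd.comp fst) snd))

theorem primrec_moves : Primrec (moves : List (Key A) × List (Key A) → List (Trans A)) := by
  have hK : Primrec fun x : List (Key A) × List (Key A) => x.1 ++ x.2 := list_append.comp fst snd
  refine list_append.comp (.const _) (list_flatMap (list_range.comp (list_length.comp hK)) ?_)
  exact primrec_keyMoves.comp (.pair (list_length.comp (fst.comp fst)) (.pair snd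
    ((list_getD _).comp (hK.comp fst) snd)))

theorem primrec_num : Primrec State.num :=
  Primrec₂.natPair.comp fst (Primrec₂.natPair.comp (fst.comp snd) (snd.comp snd))

theorem computable_code_machine :
    Computable fun x : List (Key A) × List (Key A) => (machine x).code := by
  refine Primrec.to_comp ?_
  have hK : Primrec fun x : List (Key A) × List (Key A) => x.1 ++ x.2 := list_append.comp fst snd
  have hb : Primrec (stateBound : List (Key A) × List (Key A) → ℕ) :=
    nat_add.comp (nat_add.comp (list_length.comp hK) (list_length.comp (list_flatten.comp hK)))
      (.const _)
  have hb2 := nat_mul.comp hb hb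
  refine .pair (nat_mul.comp hb2 hb2) (.pair (.const _) (.pair (.const _) (.pair (.const _) ?_)))
  exact list_map primrec_moves (Primrec.pair (primrec_num.comp (fst.comp snd))
    (.pair (fst.comp (snd.comp snd)) (.pair (primrec_num.comp (fst.comp (snd.comp (snd.comp snd))))
      (snd.comp (snd.comp (snd.comp snd))))))

end primrec

end lists

end BackwardLBA

/-! ### Computations of linear bounded automata -/

namespace LBA

variable {A : Type*}

/-- Whether a symbol is an endmarker, and which one. -/
def endKind : TapeSymbol A → Option Bool
  | .leftEnd => some false
  | .rightEnd => some true
  | _ => none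

/-- The tape has the endmarkers at its two ends and nowhere else. -/
def WellFormed (tape : List (TapeSymbol A)) : Prop :=
  ∃ n, tape.map endKind = some false :: (List.replicate n none ++ [some true])

theorem endKind_eq_some_false {x : TapeSymbol A} : endKind x = some false ↔ x = .leftEnd := by
  cases x <;> simp [endKind]

theorem endKind_eq_some_true {x : TapeSymbol A} : endKind x = some true ↔ x = .rightEnd := by
  cases x <;> simp [endKind]

theorem WellFormed.ends {l r : List (TapeSymbol A)} {x : TapeSymbol A}
    (h : WellFormed (l ++ x :: r)) : (x = .leftEnd ↔ l = []) ∧ (x = .rightEnd ↔ r = []) := by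
  obtain ⟨n, h⟩ := h
  rw [← endKind_eq_some_false, ← endKind_eq_some_true]
  cases l with
  | nil =>
    simp only [List.nil_append, List.map_cons, List.cons.injEq] at h
    have : r ≠ [] := by
      rintro rfl
      simp at h
    simp [h.1, this]
  | cons b l =>
    simp only [List.cons_append, List.map_cons, List.cons.injEq, List.map_append] at h
    rcases r.eq_nil_or_concat' with rfl | ⟨r, e, rfl⟩
    · have := List.append_inj' h.2 rfl
      simp only [List.map_nil, List.cons.injEq, and_true] at this
      simp [this.2]
    · have h2 : (l.map endKind ++ endKind x :: r.map endKind) ++ [endKind e] =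
          List.replicate n none ++ [some true] := by simpa using h.2
      have h3 := (List.append_inj' h2 rfl).1
      have : endKind x ∈ List.replicate n (none : Option Bool) := by simp [← h3]
      simp [List.eq_of_mem_replicate this]

theorem WellFormed.replace {l r : List (TapeSymbol A)} {x y : TapeSymbol A}
    (h : WellFormed (l ++ x :: r)) (h1 : x = .leftEnd ↔ y = .leftEnd)
    (h2 : x = .rightEnd ↔ y = .rightEnd) : WellFormed (l ++ y :: r) := by
  have : endKind y = endKind x := by cases x <;> cases y <;> simp_all [endKind]
  simpa [WellFormed, this] using h

theorem wellFormed_init (w : List A) :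
    WellFormed (.leftEnd :: (w.map .input ++ [.rightEnd] : List (TapeSymbol A))) := by
  refine ⟨w.length, ?_⟩
  simp [endKind, Function.comp_def]

section

variable {M : LBA A} {q q' : ℕ} {l r : List (TapeSymbol A)} {x y z : TapeSymbol A}

theorem step_stay (h : (q, x, q', y, .stay) ∈ M.trans) :
    M.Step ⟨q, l ++ x :: r, l.length⟩ ⟨q', l ++ y :: r, l.length⟩ :=
  ⟨x, y, .stay, h, by simp, by simp, rfl⟩

theorem step_right (h : (q, x, q', y, .right) ∈ M.trans) :
    M.Step ⟨q, l ++ x :: z :: r, l.length⟩ ⟨q', (l ++ [y]) ++ z :: r, (l ++ [y]).length⟩ :=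
  ⟨x, y, .right, h, by simp, by simp, by simp [HeadMove.apply]⟩

theorem step_left (h : (q, x, q', y, .left) ∈ M.trans) :
    M.Step ⟨q, (l ++ [z]) ++ x :: r, (l ++ [z]).length⟩ ⟨q', l ++ z :: y :: r, l.length⟩ :=
  ⟨x, y, .left, h, by simp, by
    rw [List.set_append_right _ _ le_rfl]
    simp, by simp [HeadMove.apply]⟩

/-- Induction along a computation. The tape is split at the head, and the endmarkers guarantee that
the head stays on it. -/
theorem reach_induction {w : List A}
    {P : ℕ → List (TapeSymbol A) → TapeSymbol A → List (TapeSymbol A) → Prop}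
    (init : P M.start [] .leftEnd (w.map .input ++ [.rightEnd]))
    (stay : ∀ q l x r q' y, P q l x r → (x = .leftEnd ↔ l = []) → (x = .rightEnd ↔ r = []) →
      (q, x, q', y, .stay) ∈ M.trans → P q' l y r)
    (right : ∀ q l x z r q' y, P q l x (z :: r) → (x = .leftEnd ↔ l = []) →
      (q, x, q', y, .right) ∈ M.trans →
      P q' (l ++ [y]) z r)
    (left : ∀ q l z x r q' y, P q (l ++ [z]) x r → (q, x, q', y, .left) ∈ M.trans →
      P q' l z (y :: r))
    {c : LBAConfig A} (hc : Relation.ReflTransGen M.Step (M.init w) c) :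
    ∃ l x r, c.tape = l ++ x :: r ∧ c.pos = l.length ∧ WellFormed (l ++ x :: r) ∧
      P c.state l x r := by
  induction hc with
  | refl => exact ⟨[], _, _, rfl, rfl, wellFormed_init w, init⟩
  | @tail c c' _ hstep ih =>
    obtain ⟨l, x, r, htape, hpos, hwf, hP⟩ := ih
    obtain ⟨x', y, d, hmem, hx, htape', hpos'⟩ := hstep
    obtain rfl : x = x' := by simpa [htape, hpos] using hx
    have hset : c'.tape = l ++ y :: r := by simp [htape', htape, hpos]
    have hwf' := hwf.replace (M.leftEnd_iff _ _ _ _ _ hmem) (M.rightEnd_iff _ _ _ _ _ hmem)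
    obtain ⟨he1, he2⟩ := hwf.ends
    cases d with
    | stay =>
      exact ⟨l, y, r, hset, by rw [hpos', hpos]; rfl, hwf', stay _ _ _ _ _ _ hP he1 he2 hmem⟩
    | right =>
      cases r with
      | nil =>
        obtain rfl := he2.2 rfl
        exact absurd rfl (M.rightEnd_move _ _ _ _ hmem)
      | cons z r =>
        refine ⟨l ++ [y], z, r, by simpa using hset, by simp [hpos', hpos, HeadMove.apply],
          by simpa using hwf', right _ _ _ _ _ _ _ hP he1 hmem⟩
    | left =>
      rcases l.eq_nil_or_concat' with rfl | ⟨l, z, rfl⟩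
      · obtain rfl := he1.2 rfl
        exact absurd rfl (M.leftEnd_move _ _ _ _ hmem)
      · refine ⟨l, z, y :: r, by simpa using hset, by simp [hpos', hpos, HeadMove.apply],
          by simpa using hwf', left _ _ _ _ _ _ _ hP hmem⟩

end

end LBA

/-! ### The language of the automaton -/

namespace BackwardLBA

open KeyConfig LBA

variable {A : Type*}

/-- The letter in a cell, if there is one. -/
def cellLetters : TapeSymbol A → List A
  | .input a => [a]
  | _ => []

/-- The remaining letters in a part of the tape. -/
def live (l : List (TapeSymbol A)) : List A := l.flatMap cellLetters

@[simp] theorem cellLetters_input (a : A) : cellLetters (.input a) = [a] := rfl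

@[simp] theorem cellLetters_leftEnd : cellLetters (.leftEnd : TapeSymbol A) = [] := rfl

@[simp] theorem cellLetters_rightEnd : cellLetters (.rightEnd : TapeSymbol A) = [] := rfl

@[simp] theorem cellLetters_aux (i : ℕ) : cellLetters (.aux i : TapeSymbol A) = [] := rfl

@[simp] theorem live_nil : live ([] : List (TapeSymbol A)) = [] := rfl

@[simp] theorem live_cons (x : TapeSymbol A) (l : List (TapeSymbol A)) :
    live (x :: l) = cellLetters x ++ live l := rfl

@[simp] theorem live_append (l r : List (TapeSymbol A)) : live (l ++ r) = live l ++ live r :=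
  List.flatMap_append

@[simp] theorem live_map_input (w : List A) : live (w.map .input) = w := by
  induction w with
  | nil => rfl
  | cons a w ih => simp [ih]

/-- From the configuration `c`, a possible end of an accepting execution leads to the word `w`. -/
def CanFinish (K : Keyboard A) (w : List A) (c : KeyConfig A) : Prop :=
  ∃ τ, K.IsAccepting τ ∧ (actKeys c τ).text = w

/-- What must hold for the configuration `c` after key number `k`. -/
def GoodAfter (K : Keyboard A) (n : ℕ) (w : List A) (k : ℕ) (c : KeyConfig A) : Prop :=
  if k < n then CanFinish K w c else c.text = w

/-- The invariant of the computations on the word `w`. The state `peek k j` is entered by a step to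
the right; hence there the cursor is left of the cell under the head. -/
def Invariant (K : Keyboard A) (T F : List (Key A)) (w : List A) :
    State → List (TapeSymbol A) → TapeSymbol A → List (TapeSymbol A) → Prop
  | (0, _, _), l, x, r => live (l ++ [x]) ++ live r = w
  | (1, _, _), l, x, r => CanFinish K w (live (l ++ [x]), live r)
  | (2, _, _), l, x, r => live l = [] ∧ CanFinish K w ([], live (x :: r))
  | (3, _, _), _, _, _ => CanFinish K w ([], [])
  | (4, k, j), l, x, r => ∀ t, (T ++ F)[k]? = some t →
      GoodAfter K T.length w k (actKey (live (l ++ [x]), live r) (t.drop j))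
  | (5, k, j), l, x, r => ∀ t, (T ++ F)[k]? = some t →
      GoodAfter K T.length w k (actKey (live l, live (x :: r)) (t.drop j))
  | _, _, _, _ => True

variable {K : Keyboard A} {T F : List (Key A)} {w : List A}

theorem drop_eq_cons {t : Key A} {j : ℕ} {o : AtomicOp A} (h : t[j]? = some o) :
    t.drop j = o :: t.drop (j + 1) := by
  obtain ⟨hj, rfl⟩ := List.getElem?_eq_some_iff.1 h
  exact List.drop_eq_getElem_cons hj

theorem CanFinish.of_goodAfter (hT : ∀ t ∈ T, t ∈ K.transient) (hF : ∀ t ∈ F, t ∈ K.final)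
    {k : ℕ} {t : Key A} (ht : (T ++ F)[k]? = some t) {c : KeyConfig A}
    (h : GoodAfter K T.length w k (actKey c t)) : CanFinish K w c := by
  unfold GoodAfter at h
  split_ifs at h with hk
  · rw [List.getElem?_append_left hk] at ht
    obtain ⟨τ, ⟨ts, f, rfl, hts, hf⟩, h⟩ := h
    refine ⟨t :: (ts ++ [f]), ⟨t :: ts, f, rfl, ?_, hf⟩, h⟩
    simpa using ⟨hT t (List.mem_of_getElem? ht), hts⟩
  · rw [List.getElem?_append_right (not_lt.1 hk)] at ht
    exact ⟨[t], ⟨[], t, rfl, by simp, hF t (List.mem_of_getElem? ht)⟩, h⟩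

section correctness

variable [Fintype A]

theorem mem_of_mem_language_machine (hT : ∀ t ∈ T, t ∈ K.transient) (hF : ∀ t ∈ F, t ∈ K.final)
    (h : w ∈ (machine (T, F)).language) : w ∈ K.language := by
  obtain ⟨c, hc, hacc⟩ := h
  obtain ⟨l, x, r, -, -, -, s, hs, hinv⟩ := reach_induction
    (P := fun q l x r => ∃ s : State, q = s.num ∧ Invariant K T F w s l x r)
    ⟨start, rfl, by simp [Invariant]⟩ (by
      rintro q l x r q' y ⟨s, rfl, hi⟩ hl hr hmem
      obtain ⟨s', rfl, hmove⟩ := mem_trans_machine.1 hmem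
      refine ⟨s', rfl, ?_⟩
      cases hmove with
      | check_rightEnd =>
        obtain rfl := hr.1 rfl
        simpa [Invariant] using hi.2
      | enter_transient ht hk hx =>
        intro t' ht'
        obtain rfl : _ = t' := Option.some.inj (ht.symm.trans ht')
        rw [List.drop_length, actKey_nil, GoodAfter, if_pos hk]
        exact hi
      | enter_final ht hk hx =>
        intro t' ht'
        obtain rfl : _ = t' := Option.some.inj (ht.symm.trans ht')
        rw [List.drop_length, actKey_nil, GoodAfter, if_neg (not_lt.2 hk)]
        exact hi
      | leave ht hx => exact .of_goodAfter hT hF ht (by simpa using hi _ ht)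
      | peek_blank ht ho => simpa [Invariant] using hi
      | peek_rightEnd ht ho => simpa [Invariant] using hi
      | letter ht ho =>
        intro t' ht'
        obtain rfl : _ = t' := Option.some.inj (ht.symm.trans ht')
        have := hi _ ht
        rw [drop_eq_cons ho, actKey_cons]
        simpa using this
      | left_leftEnd ht ho =>
        intro t' ht'
        obtain rfl : _ = t' := Option.some.inj (ht.symm.trans ht')
        have := hi _ ht
        obtain rfl := hl.1 rfl
        rw [drop_eq_cons ho, actKey_cons]
        simpa using this
      | left_input a ht ho =>
        intro t' ht'
        obtain rfl : _ = t' := Option.some.inj (ht.symm.trans ht')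
        have := hi _ ht
        rw [drop_eq_cons ho, actKey_cons]
        simpa using this
      | right_rightEnd ht ho =>
        intro t' ht'
        obtain rfl : _ = t' := Option.some.inj (ht.symm.trans ht')
        have := hi _ ht
        obtain rfl := hr.1 rfl
        rw [drop_eq_cons ho, actKey_cons]
        simpa using this) (by
      rintro q l x z r q' y ⟨s, rfl, hi⟩ hl hmem
      obtain ⟨s', rfl, hmove⟩ := mem_trans_machine.1 hmem
      refine ⟨s', rfl, ?_⟩
      cases hmove with
      | hub_leftEnd =>
        obtain rfl := hl.1 rfl
        simpa [Invariant] using hi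
      | _ => simpa [Invariant] using hi) (by
      rintro q l z x r q' y ⟨s, rfl, hi⟩ hmem
      obtain ⟨s', rfl, hmove⟩ := mem_trans_machine.1 hmem
      refine ⟨s', rfl, ?_⟩
      cases hmove with
      | right_input a ht ho =>
        intro t' ht'
        obtain rfl : _ = t' := Option.some.inj (ht.symm.trans ht')
        have := hi _ ht
        rw [drop_eq_cons ho, actKey_cons]
        simpa using this
      | _ => simpa [Invariant] using hi) hc
  have hdone : s = done := by
    have : c.state = done.num := by simpa [machine] using hacc
    exact State.num_injective (hs.symm.trans this)
  subst hdone
  obtain ⟨τ, hτ, h⟩ := hinv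
  exact ⟨τ, Keyboard.generates_iff.2 ⟨hτ, h⟩⟩

/-- The automaton can reach the state `s`, with the tape `l ++ x :: r` and the head on `x`. -/
def ReachesTape (T F : List (Key A)) (w : List A) (s : State) (l : List (TapeSymbol A))
    (x : TapeSymbol A) (r : List (TapeSymbol A)) : Prop :=
  Relation.ReflTransGen (machine (T, F)).Step ((machine (T, F)).init w)
    ⟨s.num, l ++ x :: r, l.length⟩

/-- The automaton can reach the state `s` with a tape that represents the configuration `c`. -/
def ReachesConfig (T F : List (Key A)) (w : List A) (s : State) (c : KeyConfig A) : Prop :=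
  ∃ l x r, ReachesTape T F w s l x r ∧ live (l ++ [x]) = c.1 ∧ live r = c.2

section

variable {s s' : State} {l r : List (TapeSymbol A)} {x y z : TapeSymbol A}

theorem ReachesTape.stay (h : ReachesTape T F w s l x r) (hm : Move T F s x s' y .stay) :
    ReachesTape T F w s' l y r :=
  h.tail (step_stay (mem_trans_machine.2 ⟨s', rfl, hm⟩))

theorem ReachesTape.right (h : ReachesTape T F w s l x (z :: r))
    (hm : Move T F s x s' y .right) : ReachesTape T F w s' (l ++ [y]) z r :=
  h.tail (step_right (mem_trans_machine.2 ⟨s', rfl, hm⟩))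

theorem ReachesTape.left (h : ReachesTape T F w s (l ++ [z]) x r)
    (hm : Move T F s x s' y .left) : ReachesTape T F w s' l z (y :: r) :=
  h.tail (step_left (mem_trans_machine.2 ⟨s', rfl, hm⟩))

theorem ReachesTape.wellFormed (h : ReachesTape T F w s l x r) :
    WellFormed (l ++ x :: r) ∧ ∀ i, .aux i ∈ l ++ x :: r → i = 0 := by
  obtain ⟨l', x', r', htape, hpos, hwf, hP⟩ := reach_induction
    (P := fun _ l x r => ∀ i, .aux i ∈ l ++ x :: r → i = 0) (by simp)
    (by
      intro q l x r q' y hP _ _ hmem i hi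
      obtain ⟨s, s', -, -, hm⟩ := exists_move_of_mem_transitions hmem
      have := hm.aux_eq_zero.2 i
      have := hP i
      simp only [List.mem_append, List.mem_cons] at *
      grind)
    (by
      intro q l x z r q' y hP _ hmem i hi
      obtain ⟨s, s', -, -, hm⟩ := exists_move_of_mem_transitions hmem
      have := hm.aux_eq_zero.2 i
      have := hP i
      simp only [List.mem_append, List.mem_cons] at *
      grind)
    (by
      intro q l x z r q' y hP hmem i hi
      obtain ⟨s, s', -, -, hm⟩ := exists_move_of_mem_transitions hmem
      have := hm.aux_eq_zero.2 i
      have := hP i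
      simp only [List.mem_append, List.mem_cons] at *
      grind) h
  simp only at htape
  rw [htape]
  exact ⟨hwf, hP⟩

theorem ReachesTape.cases_symbol (h : ReachesTape T F w s l x r) :
    (x = .leftEnd ∧ l = []) ∨ (x = .rightEnd ∧ r = [] ∧ l ≠ []) ∨
      ((∃ a, x = .input a) ∨ x = blank) ∧ l ≠ [] ∧ r ≠ [] := by
  obtain ⟨h1, h2⟩ := h.wellFormed
  obtain ⟨h3, h4⟩ := h1.ends
  cases x with
  | leftEnd => exact .inl ⟨rfl, h3.1 rfl⟩
  | rightEnd => exact .inr (.inl ⟨rfl, h4.1 rfl, by simpa using h3⟩)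
  | input a => exact .inr (.inr ⟨.inl ⟨a, rfl⟩, by simpa using h3, by simpa using h4⟩)
  | aux i =>
    obtain rfl := h2 i (by simp)
    exact .inr (.inr ⟨.inr rfl, by simpa using h3, by simpa using h4⟩)

/-- The head can be moved to the left over the cells without a letter. -/
theorem ReachesConfig.toLast {c : KeyConfig A} (h : ReachesConfig T F w s c)
    (h1 : Move T F s blank s blank .left) (h2 : Move T F s .rightEnd s .rightEnd .left) :
    ∃ l x r, ReachesTape T F w s l x r ∧ live r = c.2 ∧
      ((x = .leftEnd ∧ l = [] ∧ c.1 = []) ∨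
        ∃ a l' z, x = .input a ∧ l = l' ++ [z] ∧ c.1 = live l ++ [a]) := by
  obtain ⟨l, x, r, h, hl, hr⟩ := h
  induction l using List.reverseRecOn generalizing x r with
  | nil =>
    rcases h.cases_symbol with ⟨rfl, -⟩ | h' | h'
    · exact ⟨[], _, r, h, hr, .inl ⟨rfl, rfl, by simpa using hl.symm⟩⟩
    · exact absurd rfl h'.2.2
    · exact absurd rfl h'.2.1
  | append_singleton l z ih =>
    rcases h.cases_symbol with h' | ⟨rfl, -⟩ | ⟨⟨a, rfl⟩ | rfl, -⟩
    · simp at h'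
    · exact ih _ _ (h.left h2) (by simpa using hl) (by simpa using hr)
    · exact ⟨l ++ [z], _, r, h, hr, .inr ⟨a, l, z, rfl, rfl, by simpa using hl.symm⟩⟩
    · exact ih _ _ (h.left h1) (by simpa using hl) (by simpa using hr)

variable {k j : ℕ} {t : Key A} {o : AtomicOp A}

theorem ReachesTape.toPeek (ht : (T ++ F)[k]? = some t) (ho : t[j]? = some o)
    (h : ReachesTape T F w (undo k (j + 1)) l x (z :: r)) :
    ReachesTape T F w (peek k (j + 1)) (l ++ [x]) z r := by
  rcases h.cases_symbol with ⟨rfl, -⟩ | h' | ⟨⟨a, rfl⟩ | rfl, -⟩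
  · exact h.right (.toPeek_leftEnd ht ho)
  · simp at h'
  · exact h.right (.toPeek_input a ht ho)
  · exact h.right (.toPeek_blank ht ho)

/-- The head can be moved to the right over the cells without a letter. -/
theorem ReachesConfig.toNext (ht : (T ++ F)[k]? = some t) (ho : t[j]? = some o) {c : KeyConfig A}
    (h : ReachesConfig T F w (undo k (j + 1)) c) :
    ∃ l x r, ReachesTape T F w (undo k (j + 1)) l x r ∧ live (l ++ [x]) = c.1 ∧
      ((r = [] ∧ x = .rightEnd ∧ c.2 = []) ∨ ∃ a r', r = .input a :: r' ∧ c.2 = a :: live r') := by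
  obtain ⟨l, x, r, h, hl, hr⟩ := h
  induction r generalizing l x with
  | nil =>
    rcases h.cases_symbol with ⟨rfl, rfl⟩ | h' | h'
    · have := h.wellFormed.1.ends.2.2 rfl
      simp at this
    · exact ⟨l, x, [], h, hl, .inl ⟨rfl, h'.1, by simpa using hr.symm⟩⟩
    · simp at h'
  | cons z r ih =>
    have hp := h.toPeek ht ho
    rcases hp.cases_symbol with h' | ⟨rfl, -⟩ | ⟨⟨a, rfl⟩ | rfl, -⟩
    · simp at h'
    · exact ih _ _ (hp.stay (.peek_rightEnd ht ho)) (by simpa using hl) (by simpa using hr)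
    · exact ⟨l, x, _, h, hl, .inr ⟨a, r, rfl, by simpa using hr.symm⟩⟩
    · exact ih _ _ (hp.stay (.peek_blank ht ho)) (by simpa using hl) (by simpa using hr)

theorem ReachesConfig.undoOp (ht : (T ++ F)[k]? = some t) (ho : t[j]? = some o)
    (hb : o ≠ .backspace) {c : KeyConfig A}
    (h : ReachesConfig T F w (undo k (j + 1)) (act c o)) :
    ReachesConfig T F w (undo k j) c := by
  refine act_cases (P := fun c o d => t[j]? = some o → ReachesConfig T F w (undo k (j + 1)) d →
    ReachesConfig T F w (undo k j) c) ?_ ?_ ?_ ?_ ?_ c o hb ho h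
  · intro u v a ho h
    obtain ⟨l, x, r, h, hr, h' | ⟨b, l', z, rfl, -, h'⟩⟩ :=
      h.toLast (.undo_blank ht ho) (.undo_rightEnd ht ho)
    · simp at h'
    · obtain ⟨rfl, h'⟩ := List.append_inj' h' rfl
      obtain rfl : a = b := by simpa using h'
      exact ⟨_, _, _, h.stay (.letter ht ho), by simp, hr⟩
  · intro v ho h
    obtain ⟨l, x, r, h, hr, ⟨rfl, rfl, -⟩ | ⟨b, l', z, -, -, h'⟩⟩ :=
      h.toLast (.undo_blank ht ho) (.undo_rightEnd ht ho)
    · exact ⟨_, _, _, h.stay (.left_leftEnd ht ho), by simp, hr⟩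
    · simp at h'
  · intro u v a ho h
    obtain ⟨l, x, r, hr, hl, h' | ⟨b, r', rfl, h'⟩⟩ := h.toNext ht ho
    · simp at h'
    · simp only [List.cons.injEq] at h'
      obtain ⟨rfl, rfl⟩ := h'
      exact ⟨_, _, _, (hr.toPeek ht ho).stay (.left_input _ ht ho), by
        rw [live_append, hl]
        simp, rfl⟩
  · intro u ho h
    obtain ⟨l, x, r, h, hl, ⟨rfl, rfl, -⟩ | ⟨b, r', -, h'⟩⟩ := h.toNext ht ho
    · exact ⟨_, _, _, h.stay (.right_rightEnd ht ho), hl, rfl⟩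
    · simp at h'
  · intro u v a ho h
    obtain ⟨l, x, r, h, hr, h' | ⟨b, l', z, rfl, rfl, h'⟩⟩ :=
      h.toLast (.undo_blank ht ho) (.undo_rightEnd ht ho)
    · simp at h'
    · obtain ⟨rfl, h'⟩ := List.append_inj' h' rfl
      obtain rfl : a = b := by simpa using h'
      exact ⟨_, _, _, h.left (.right_input a ht ho), rfl, by simpa using hr⟩

theorem ReachesConfig.undoKey (ht : (T ++ F)[k]? = some t) (hb : .backspace ∉ t)
    {c : KeyConfig A} (h : ReachesConfig T F w (undo k t.length) (actKey c t)) :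
    ReachesConfig T F w hub c := by
  have key : ∀ j ≤ t.length, ReachesConfig T F w (undo k j) (actKey c (t.take j)) →
      ReachesConfig T F w (undo k 0) c := by
    intro j
    induction j with
    | zero => exact fun _ h => by simpa using h
    | succ j ih =>
      intro hj h
      refine ih (by omega) (ReachesConfig.undoOp ht (o := t[j]) (by simp) ?_ ?_)
      · exact fun h => hb (h ▸ List.getElem_mem _)
      · rwa [List.take_succ_eq_append_getElem (by omega), actKey_append] at h
  obtain ⟨l, x, r, h, hl, hr⟩ := key t.length le_rfl (by simpa using h)
  exact ⟨l, x, r, h.stay (.leave ht fun i hi => h.wellFormed.2 i (by simp [hi])), hl, hr⟩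

theorem reachesConfig_start (u v : List A) (hw : w = u ++ v) :
    ReachesConfig T F w start (u, v) := by
  suffices H : ∃ l x, l ++ [x] = .leftEnd :: u.map .input ∧
      ReachesTape T F w start l x (v.map .input ++ [.rightEnd]) by
    obtain ⟨l, x, h, h'⟩ := H
    exact ⟨l, x, _, h', by rw [h]; simp, by simp⟩
  induction u using List.reverseRecOn generalizing v with
  | nil =>
    refine ⟨[], .leftEnd, rfl, ?_⟩
    subst hw
    exact .refl
  | append_singleton u a ih =>
    obtain ⟨l, x, h, h'⟩ := ih (a :: v) (by simpa using hw)
    refine ⟨l ++ [x], .input a, by simp [h], ?_⟩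
    rcases l with _ | ⟨y, l⟩
    · obtain rfl : x = .leftEnd := by simp_all
      exact h'.right .start_leftEnd
    · have : x ∈ u.map (TapeSymbol.input : A → _) := by
        simp only [List.cons_append, List.cons.injEq] at h
        rw [← h.2]
        simp
      obtain ⟨b, -, rfl⟩ := List.mem_map.1 this
      exact h'.right (.start_input b)

theorem reachesTape_done (h : ReachesTape T F w check l x r) (hx : live (x :: r) = [])
    (hl : l ≠ []) : ∃ l x r, ReachesTape T F w done l x r := by
  induction r generalizing l x with
  | nil =>
    rcases h.cases_symbol with h' | ⟨rfl, -⟩ | h'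
    · exact absurd h'.2 hl
    · exact ⟨_, _, _, h.stay .check_rightEnd⟩
    · simp at h'
  | cons z r ih =>
    rcases h.cases_symbol with h' | h' | ⟨⟨a, rfl⟩ | rfl, -⟩
    · exact absurd h'.2 hl
    · simp at h'
    · simp at hx
    · exact ih (h.right .check_blank) (by simpa using hx) (by simp)

end

theorem mem_language_machine_of_mem (hK : K.IsEAK) (hT : ∀ t ∈ K.transient, t ∈ T)
    (hF : ∀ t ∈ K.final, t ∈ F) (h : w ∈ K.language) : w ∈ (machine (T, F)).language := by
  obtain ⟨ts, f, hts, hf, h⟩ := Keyboard.mem_language.1 h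
  have hub_final : ReachesConfig T F w hub (actKeys ([], []) ts) := by
    obtain ⟨i, hi⟩ := List.getElem?_of_mem (hF f hf)
    have ht : (T ++ F)[T.length + i]? = some f := by
      rw [List.getElem?_append_right (by omega), Nat.add_sub_cancel_left, hi]
    obtain ⟨l, x, r, hr, h1, h2⟩ := reachesConfig_start (T := T) (F := F) (w := w)
      (actKey (actKeys ([], []) ts) f).1 (actKey (actKeys ([], []) ts) f).2 h.symm
    refine ReachesConfig.undoKey ht (hK.2 f hf) ⟨l, x, r, hr.stay ?_, h1, h2⟩
    exact .enter_final ht (by omega) fun i hi => hr.wellFormed.2 i (by simp [hi])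
  have hub_all : ∀ c : KeyConfig A, ReachesConfig T F w hub (actKeys c ts) →
      ReachesConfig T F w hub c := by
    clear hub_final h
    induction ts with
    | nil => exact fun c h => h
    | cons t ts ih =>
      intro c h
      simp only [List.forall_mem_cons] at hts
      obtain ⟨l, x, r, hr, h1, h2⟩ := ih hts.2 _ h
      obtain ⟨i, hi⟩ := List.getElem?_of_mem (hT t hts.1)
      have hil : i < T.length := (List.getElem?_eq_some_iff.1 hi).1
      have ht : (T ++ F)[i]? = some t := by
        rw [List.getElem?_append_left hil, hi]
      refine ReachesConfig.undoKey ht (hK.1 t hts.1) ⟨l, x, r, hr.stay ?_, h1, h2⟩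
      exact .enter_transient ht hil fun i hi => hr.wellFormed.2 i (by simp [hi])
  obtain ⟨l, x, r, hr, h2, ⟨rfl, rfl, -⟩ | ⟨a, l', z, -, -, h'⟩⟩ :=
    (hub_all _ hub_final).toLast .hub_blank .hub_rightEnd
  · cases r with
    | nil =>
      have := hr.wellFormed.1.ends.2.2 rfl
      simp at this
    | cons z r =>
      obtain ⟨l, x, r, hd⟩ := reachesTape_done (hr.right .hub_leftEnd) h2 (by simp)
      exact ⟨_, hd, List.mem_singleton_self _⟩
  · simp at h'

theorem language_machine (hK : K.IsEAK) (hT : ∀ t, t ∈ T ↔ t ∈ K.transient)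
    (hF : ∀ t, t ∈ F ↔ t ∈ K.final) : (machine (T, F)).language = K.language := by
  ext w
  exact ⟨mem_of_mem_language_machine (fun t => (hT t).1) (fun t => (hF t).1),
    mem_language_machine_of_mem hK (fun t => (hT t).2) (fun t => (hF t).2)⟩

/-! ### The size of the automaton -/

theorem length_inputs : (inputs A).length = Fintype.card A := by
  simp [inputs]

theorem length_opMoves_le (k : ℕ) (t : Key A) (j : ℕ) :
    (opMoves k t j).length ≤ 4 * Fintype.card A + 8 := by
  classical
  have h1 : (freeMoves (undo k (j + 1)) (peek k (j + 1)) : List (Trans A)).length =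
      Fintype.card A + 6 := by
    simp [freeMoves, length_inputs]
  have h2 : ∀ p r p' (o : AtomicOp A), (undoMoves p r p' o).length ≤ 3 * Fintype.card A + 2 := by
    intro p r p' o
    refine (List.length_filterMap_le _ _).trans ?_
    simp [allUndoMoves, length_inputs]
    omega
  rw [opMoves, List.length_append, h1]
  have := h2 (undo k (j + 1)) (peek k (j + 1)) (undo k j) (t.getD j .backspace)
  omega

theorem length_flatMap_le {α β : Type*} (l : List α) (f : α → List β) (n : ℕ)
    (h : ∀ a ∈ l, (f a).length ≤ n) : (l.flatMap f).length ≤ l.length * n := by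
  rw [List.length_flatMap]
  have := List.sum_le_card_nsmul (l.map fun a => (f a).length) n (by simpa using h)
  simpa using this

theorem length_moves_le (T F : List (Key A)) {m : ℕ} (hm : stateBound (T, F) ≤ m) :
    (moves (T, F)).length ≤
      6 + Fintype.card A + m * (2 * (Fintype.card A + 3) + m * (4 * Fintype.card A + 8)) := by
  have h1 : (fixedMoves A).length = 6 + Fintype.card A := by
    simp [fixedMoves, length_inputs]
    omega
  have h2 : ∀ s s' : State, (jump s s' : List (Trans A)).length = Fintype.card A + 3 := by
    intro s s'
    simp [jump, symbols, length_inputs]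
  have h3 : ∀ k ∈ List.range (T ++ F).length,
      (keyMoves T.length k ((T ++ F).getD k [])).length ≤
        2 * (Fintype.card A + 3) + m * (4 * Fintype.card A + 8) := by
    intro k hk
    have hmem : (T ++ F).getD k [] ∈ T ++ F := by
      rw [List.getD_eq_getElem _ _ (List.mem_range.1 hk)]
      exact List.getElem_mem _
    have hlen : ((T ++ F).getD k []).length ≤ (T ++ F).flatten.length := by
      rw [List.length_flatten]
      exact List.le_sum_of_mem (List.mem_map_of_mem hmem)
    generalize (T ++ F).getD k [] = t at hlen
    have h4 := length_flatMap_le (List.range t.length) (opMoves k t) _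
      fun j _ => length_opMoves_le k t j
    rw [List.length_range] at h4
    have h5 : t.length * (4 * Fintype.card A + 8) ≤ m * (4 * Fintype.card A + 8) := by
      refine Nat.mul_le_mul_right _ (hlen.trans (le_trans ?_ hm))
      simp only [stateBound]
      omega
    simp only [keyMoves, List.length_append, h2]
    omega
  have h4 := length_flatMap_le _ _ _ h3
  rw [List.length_range] at h4
  rw [moves, List.length_append, h1]
  refine Nat.add_le_add_left (h4.trans (Nat.mul_le_mul_right _ (le_trans ?_ hm))) _
  simp only [stateBound]
  omega

omit [Fintype A] in
theorem stateBound_le (hTn : T.Nodup) (hFn : F.Nodup) (hT : ∀ t, t ∈ T ↔ t ∈ K.transient)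
    (hF : ∀ t, t ∈ F ↔ t ∈ K.final) : stateBound (T, F) ≤ 2 * K.size + 6 := by
  classical
  have key : ∀ L : List (Key A), L.Nodup → (∀ t ∈ L, t ∈ K.transient ∪ K.final) →
      L.length + L.flatten.length ≤ K.size := by
    intro L hL hsub
    have h1 : L.length + L.flatten.length = ∑ t ∈ L.toFinset, (t.length + 1) := by
      rw [List.sum_toFinset _ hL, List.length_flatten]
      clear hL hsub
      induction L with
      | nil => rfl
      | cons t L ih =>
        simp only [List.length_cons, List.map_cons, List.sum_cons] at ih ⊢
        omega
    rw [h1, Keyboard.size]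
    refine le_trans (Finset.sum_le_sum_of_subset fun t ht => ?_) (le_of_eq (by congr!))
    exact hsub t (List.mem_toFinset.1 ht)
  have h1 := key T hTn fun t ht => Finset.mem_union_left _ ((hT t).1 ht)
  have h2 := key F hFn fun t ht => Finset.mem_union_right _ ((hF t).1 ht)
  simp only [stateBound, List.length_append, List.flatten_append]
  omega

/-- The bound for the size of the automaton. -/
noncomputable def sizePoly : Polynomial ℕ :=
  (2 * .X + 6) * (2 * .X + 6) * ((2 * .X + 6) * (2 * .X + 6)) + (.X + 3) +
    (6 + .X + (2 * .X + 6) * (2 * (.X + 3) + (2 * .X + 6) * (4 * .X + 8))) + 1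

theorem size_machine_le (hTn : T.Nodup) (hFn : F.Nodup) (hT : ∀ t, t ∈ T ↔ t ∈ K.transient)
    (hF : ∀ t, t ∈ F ↔ t ∈ K.final) :
    (machine (T, F)).size ≤ sizePoly.eval (Fintype.card A + K.size) := by
  have hb : stateBound (T, F) ≤ 2 * (Fintype.card A + K.size) + 6 :=
    (stateBound_le hTn hFn hT hF).trans (by omega)
  have hm := length_moves_le T F hb
  have ha : Fintype.card A ≤ Fintype.card A + K.size := by omega
  have hsize : (machine (T, F)).size = stateBound (T, F) * stateBound (T, F) *
      (stateBound (T, F) * stateBound (T, F)) + (Fintype.card A + 1 + 2) +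
      (moves (T, F)).length + 1 := by
    simp [LBA.size, machine, transitions]
  rw [hsize]
  simp only [sizePoly, Polynomial.eval_add, Polynomial.eval_mul, Polynomial.eval_X,
    Polynomial.eval_ofNat, Polynomial.eval_one]
  generalize Fintype.card A + K.size = n at *
  have h1 := Nat.mul_le_mul hb hb
  have h2 := Nat.mul_le_mul h1 h1
  refine Nat.add_le_add_right (Nat.add_le_add (Nat.add_le_add h2 (by omega)) (hm.trans ?_)) 1
  gcongr

end correctness

end BackwardLBA

theorem mainTheorem3 :
    ∃ p : Polynomial ℕ, ∀ (A : Type*) [Fintype A] [Primcodable A],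
      -- a computable construction of a linear bounded automaton of polynomial size;
      -- its input is any listing, without repetitions, of the transient and of the final keys
      (∃ M : List (Key A) × List (Key A) → LBA A,
        Computable (fun x => (M x).code) ∧
        ∀ K : Keyboard A, K.IsEAK →
          ∀ T F : List (Key A), T.Nodup → F.Nodup →
            (∀ t, t ∈ T ↔ t ∈ K.transient) → (∀ t, t ∈ F ↔ t ∈ K.final) →
            (M (T, F)).language = K.language ∧
              (M (T, F)).size ≤ p.eval (Fintype.card A + K.size)) ∧
      -- languages of this class are context-sensitive
      (∀ K : Keyboard A, K.IsEAK → K.language.IsContextSensitive) ∧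
      -- every word has a short accepting execution
      (∀ K : Keyboard A, K.IsEAK → ∀ w ∈ K.language,
        ∃ τ : List (Key A), K.Generates τ w ∧ τ.length ≤ w.length ^ 2 + 1) := by
  refine ⟨BackwardLBA.sizePoly, fun A _ _ => ⟨⟨BackwardLBA.machine,
    BackwardLBA.computable_code_machine, fun K hK T F hTn hFn hT hF => ⟨?_, ?_⟩⟩, ?_, ?_⟩⟩
  · exact BackwardLBA.language_machine hK hT hF
  · exact BackwardLBA.size_machine_le hTn hFn hT hF
  · exact fun K hK => Keyboard.language_isContextSensitive hK
  · exact fun K hK w hw => Keyboard.exists_short_execution hK hw
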